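/- All graphs are over a common finite set $V$ of nodes and may contain undirected edges ($A - B$), directed edges ($A \to B$) and bidirected edges ($A \leftrightarrow B$), with no loops and at most one edge between any two nodes. Below, $A \mathrel{\circ\!\!\to} B$ (equivalently $B \mathrel{\leftarrow\!\!\circ} A$) stands for $A \to B$ or $A \leftrightarrow B$. Such a graph $G$ is a *marginal AMP (MAMP) chain graph* if: (C1) there is no sequence $V_1,\dots,V_n=V_1$ with $V_1 \to V_2$ in $G$ and, for every $1<i<n$, $V_i \to V_{i+1}$, $V_i - V_{i+1}$ or $V_i \leftrightarrow V_{i+1}$ in $G$; (C2) there is no sequence $V_1,\dots,V_n=V_1$ with $V_1 \leftrightarrow V_2$ in $G$ and $V_i - V_{i+1}$ in $G$ for every $1<i<n$; (C3) if $V_1 - V_2 - V_3$ is in $G$ with $V_1 \neq V_3$ and there is some edge $V_2 \leftrightarrow W$ in $G$, then $V_1 - V_3$ is in $G$. A path is a sequence of distinct nodes in which consecutive nodes are adjacent. A node $B$ in a path $\rho$ is a *triplex node* in $\rho$ if $A \mathrel{\circ\!\!\to} B \mathrel{\leftarrow\!\!\circ} C$, $A \mathrel{\circ\!\!\to} B -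 C$ or $A - B \mathrel{\leftarrow\!\!\circ} C$ is a subpath of $\rho$. For $Z \subseteq V$, the path $\rho$ is *$Z$-open* if (i) every triplex node in $\rho$ is in $Z$ or is the start of a path $B \to \cdots \to D$ of directed edges in $G$ with $D \in Z$, and (ii) every non-triplex node $B$ in $\rho$ is outside $Z$, unless $A - B - C$ is a subpath of $\rho$ and, moreover, $G$ has an edge $B \leftrightarrow D$ or an edge $D \to B$ with $D \notin Z$ (in the bidirected case, $D$ is arbitrary). For pairwise disjoint $X, Y, Z \subseteq V$, $X$ is separated from $Y$ given $Z$ in $G$ if there is no $Z$-open path in $G$ between a node in $X$ and a node in $Y$. The *independence model* represented by $G$ is the set of all such separations $(X, Y, Z)$. A *triplex* $(\{A,C\},B)$ in $G$, with $A$, $B$, $C$ distinct, is an induced subgraph of the form $A \mathrel{\circ\!\!\to} B \mathrel{\leftarrow\!\!\circ} C$, $A \mathrel{\circ\!\!\to} B - C$ or $A - B \mathrel{\leftarrow\!\!\circ} C$ (so $A$ and $C$ are not adjacent). **Theorem.** Two MAMP chain graphs $G$ and $H$ over $V$ represent the same independence model (are Markov equivalent) if and only if they have the same adjacencies and the same triplexes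 (are triplex equivalent). -/

import Mathlib

/-- A graph that may have undirected, directed and bidirected edges:
no loops, and at most one edge between any pair of nodes. -/
structure MixedGraph (V : Type*) where
  /-- `undir a b` : the edge `a - b` is in the graph. -/
  undir : SimpleGraph V
  /-- `bidir a b` : the edge `a ↔ b` is in the graph. -/
  bidir : SimpleGraph V
  /-- `dir a b` : the edge `a → b` is in the graph. -/
  dir : V → V → Prop
  dir_irrefl : ∀ a, ¬ dir a a
  dir_asymm : ∀ a b, dir a b → ¬ dir b a
  not_undir_of_dir : ∀ a b, dir a b → ¬ undir.Adj a b
  not_bidir_of_dir : ∀ a b, dir a b → ¬ bidir.Adj a b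
  not_bidir_of_undir : ∀ a b, undir.Adj a b → ¬ bidir.Adj a b

namespace MixedGraph

variable {V : Type*}

/-- The skeleton: two nodes are adjacent if there is an edge of any kind between them. Routes and
paths of the mixed graph are the walks and paths of its skeleton (between two nodes there is at
most one edge, so a route is determined by its nodes). -/
def skeleton (G : MixedGraph V) : SimpleGraph V where
  Adj a b := G.undir.Adj a b ∨ G.dir a b ∨ G.dir b a ∨ G.bidir.Adj a b
  symm := ⟨fun a b h => by
    rcases h with h | h | h | h
    · exact Or.inl h.symm
    · exact Or.inr (Or.inr (Or.inl h))
    · exact Or.inr (Or.inl h)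
    · exact Or.inr (Or.inr (Or.inr h.symm))⟩
  loopless := ⟨fun a h => by
    rcases h with h | h | h | h
    · exact G.undir.irrefl h
    · exact G.dir_irrefl a h
    · exact G.dir_irrefl a h
    · exact G.bidir.irrefl h⟩

/-- The parents of a set of nodes. -/
def parents (G : MixedGraph V) (X : Set V) : Set V :=
  {a | a ∉ X ∧ ∃ b ∈ X, G.dir a b}

/-- The spouses of a set of nodes. -/
def spouses (G : MixedGraph V) (X : Set V) : Set V :=
  {a | a ∉ X ∧ ∃ b ∈ X, G.bidir.Adj a b}

/-- There is a descending route from the first node to the second one: each step is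
`a → b`, `a - b` or `a ↔ b`. -/
def DescendingRoute (G : MixedGraph V) : V → V → Prop :=
  Relation.ReflTransGen fun a b => G.dir a b ∨ G.undir.Adj a b ∨ G.bidir.Adj a b

/-- There is a strictly descending route from the first node to the second one: each step is
`a → b`. -/
def StrictlyDescendingRoute (G : MixedGraph V) : V → V → Prop :=
  Relation.ReflTransGen G.dir

/-- The strict ascendants of a set of nodes. -/
def strictAscendants (G : MixedGraph V) (X : Set V) : Set V :=
  {a | a ∉ X ∧ ∃ b ∈ X, G.StrictlyDescendingRoute a b}

/-- `G` is a marginal AMP chain graph. -/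
structure IsMAMP (G : MixedGraph V) : Prop where
  /-- There is no semidirected cycle, i.e. no edge `a → b` followed by a descending route
  from `b` back to `a`. -/
  no_semidirected_cycle : ∀ a b, G.dir a b → ¬ G.DescendingRoute b a
  /-- There is no cycle made of one bidirected edge and otherwise undirected edges. -/
  no_bidirected_cycle : ∀ a b, G.bidir.Adj a b → ¬ G.undir.Reachable b a
  /-- If `a - b - c` is in the graph, with distinct nodes, and `b` has a spouse, then `a - c` is
  in the graph. -/
  undir_of_spouse : ∀ a b c, a ≠ c → G.undir.Adj a b → G.undir.Adj b c →
    (G.spouses {b}).Nonempty → G.undir.Adj a c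

/-- The edge between `a` and `b` has an arrow tip at `b`, i.e. it is `a → b` or `a ↔ b`. -/
def ArrowInto (G : MixedGraph V) (a b : V) : Prop :=
  G.dir a b ∨ G.bidir.Adj a b

/-- The two edges between `a` and `b` and between `b` and `c` meet at `b` in one of the following
ways (`o` is an unspecified end): `a o→ b ←o c`, `a o→ b - c` or `a - b ←o c`. -/
def TriplexPattern (G : MixedGraph V) (a b c : V) : Prop :=
  (G.ArrowInto a b ∧ G.ArrowInto c b) ∨
  (G.ArrowInto a b ∧ G.undir.Adj b c) ∨
  (G.undir.Adj a b ∧ G.ArrowInto c b)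

/-- `b` is a triplex node in the path `p`. -/
def IsTriplexNode (G : MixedGraph V) {x y : V} (p : G.skeleton.Walk x y) (b : V) : Prop :=
  ∃ a c, [a, b, c] <:+: p.support ∧ G.TriplexPattern a b c

/-- The path `p` is `Z`-open: every triplex node in it is in `Z` or is a strict ascendant of `Z`,
and every other node `b` in it is outside `Z`, unless `a - b - c` is a subpath of `p` and
`b` has a spouse or a parent outside `Z`. -/
def IsOpen (G : MixedGraph V) {x y : V} (p : G.skeleton.Walk x y) (Z : Set V) : Prop :=
  (∀ b ∈ p.support, G.IsTriplexNode p b → b ∈ Z ∪ G.strictAscendants Z) ∧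
  (∀ b ∈ p.support, ¬ G.IsTriplexNode p b → b ∉ Z ∨
    ((∃ a c, [a, b, c] <:+: p.support ∧ G.undir.Adj a b ∧ G.undir.Adj b c) ∧
      ((G.spouses {b}).Nonempty ∨ (G.parents {b} \ Z).Nonempty)))

/-- `X` is separated from `Y` given `Z`: there is no `Z`-open path between a node in `X` and a
node in `Y`. -/
def Separated (G : MixedGraph V) (X Y Z : Set V) : Prop :=
  ∀ x ∈ X, ∀ y ∈ Y, ¬ ∃ p : G.skeleton.Walk x y, p.IsPath ∧ G.IsOpen p Z

/-- The independence model represented by `G`: the set of all triples `(X, Y, Z)` of pairwise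
disjoint sets of nodes such that `X` is separated from `Y` given `Z`. -/
def independenceModel (G : MixedGraph V) : Set (Set V × Set V × Set V) :=
  {t | Disjoint t.1 t.2.1 ∧ Disjoint t.1 t.2.2 ∧ Disjoint t.2.1 t.2.2 ∧
    G.Separated t.1 t.2.1 t.2.2}

/-- Two graphs are Markov equivalent if they represent the same independence model. -/
def MarkovEquivalent (G H : MixedGraph V) : Prop :=
  G.independenceModel = H.independenceModel

/-- `G` has the triplex `({a, c}, b)`: the subgraph induced by the distinct nodes `a`, `b`, `c` is
`a o→ b ←o c`, `a o→ b - c` or `a - b ←o c`. In particular, `a` and `c` are not adjacent. -/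
def HasTriplex (G : MixedGraph V) (a c b : V) : Prop :=
  a ≠ c ∧ ¬ G.skeleton.Adj a c ∧ G.TriplexPattern a b c

/-- The triplexes `({a, c}, b)` of `G`. -/
def triplexes (G : MixedGraph V) : Set (Sym2 V × V) :=
  {t | ∃ a c, t.1 = s(a, c) ∧ G.HasTriplex a c t.2}

/-- Two graphs are triplex equivalent if they have the same adjacencies and the same triplexes. -/
def TriplexEquivalent (G H : MixedGraph V) : Prop :=
  G.skeleton = H.skeleton ∧ G.triplexes = H.triplexes

end MixedGraph

/-! Two non-adjacent nodes can always be separated (`exists_not_openConn`), so the independence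
model determines the adjacencies. It also determines the triplexes: if `a` and `c` are non-adjacent
neighbours of `b`, a set separating them omits `b` if there is a triplex at `b` and contains `b`
otherwise.

Conversely, fix `Z` and take a lightest `Z`-open route of `G`, each visit to a node costing the
number of its descendants along directed edges. Routes may repeat nodes, which removes the exemption
for nodes `b` of `Z` between undirected edges: a spouse of `b` gives a shortcut by (C3), a parent
`d` outside `Z` gives the detour `b ← d → b` (`Exit.exists_exit`). Since shortcuts would be lighter,
even the shielded triples of the route are triplexes in `H` exactly when they are in `G`
(`Mid.triplexPattern`, `Mid.not_triplexPattern`).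

What can still fail is that a triplex node `b` is an ancestor of `Z` in `G` but not in `H`. Consider
a shortest directed chain from `b` to `Z` in `G`. If its first edge `b → d` is also in `H`, so is
the whole chain. Otherwise `Setting.dir_of_distTo` yields `b - d` in `H` and a neighbour of `b` on
the route that is a parent of `b` and `d` in `H`; the route of `H` is then led around through the
chain (`Setting.transfer_step`). Finally, loops can be cut out of open routes (`OpenList.cut`), so
routes and paths connect the same nodes (`openConn_iff`). -/

namespace MixedGraph

variable {V : Type*} {G : MixedGraph V}

/-! ### Triangles in a MAMP chain graph. -/

section Triangles

lemma skeleton_adj_iff {a b : V} : G.skeleton.Adj a b ↔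
    G.undir.Adj a b ∨ G.dir a b ∨ G.dir b a ∨ G.bidir.Adj a b := Iff.rfl

/-- A step of a descending route. -/
def Into (G : MixedGraph V) (a b : V) : Prop :=
  G.dir a b ∨ G.undir.Adj a b ∨ G.bidir.Adj a b

lemma descendingRoute_of_into {a b : V} (h : G.Into a b) : G.DescendingRoute a b :=
  Relation.ReflTransGen.single h

lemma StrictlyDescendingRoute.descendingRoute {a b : V} (h : G.StrictlyDescendingRoute a b) :
    G.DescendingRoute a b :=
  Relation.ReflTransGen.mono (fun _ _ h => Or.inl h) _ _ h

/-- Any edge other than `a → d` is a descending step from `d` to `a` and closes a semidirected cycle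
through `b → c`. -/
lemma dir_of_descendingRoute (hG : G.IsMAMP) {a b c d : V} (hab : G.DescendingRoute a b)
    (hbc : G.dir b c) (hcd : G.DescendingRoute c d) (had : G.skeleton.Adj a d) : G.dir a d := by
  by_contra hn
  have hda : G.Into d a := by
    rcases had with h | h | h | h
    · exact Or.inr (Or.inl h.symm)
    · exact absurd h hn
    · exact Or.inl h
    · exact Or.inr (Or.inr h.symm)
  exact hG.no_semidirected_cycle b c hbc ((hcd.trans (descendingRoute_of_into hda)).trans hab)

lemma dir_of_dir_into (hG : G.IsMAMP) {a b c : V} (hab : G.dir a b) (hbc : G.Into b c)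
    (hac : G.skeleton.Adj a c) : G.dir a c :=
  dir_of_descendingRoute hG .refl hab (descendingRoute_of_into hbc) hac

lemma dir_of_into_dir (hG : G.IsMAMP) {a b c : V} (hab : G.Into a b) (hbc : G.dir b c)
    (hac : G.skeleton.Adj a c) : G.dir a c :=
  dir_of_descendingRoute hG (descendingRoute_of_into hab) hbc .refl hac

lemma undir_or_bidir_of_into (hG : G.IsMAMP) {a b c : V}
    (hab : G.undir.Adj a b ∨ G.bidir.Adj a b) (hbc : G.undir.Adj b c ∨ G.bidir.Adj b c)
    (hac : G.skeleton.Adj a c) : G.undir.Adj a c ∨ G.bidir.Adj a c := by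
  have hs : ∀ {u v}, G.undir.Adj u v ∨ G.bidir.Adj u v → G.undir.Adj v u ∨ G.bidir.Adj v u :=
    fun h => h.imp (fun h => h.symm) (fun h => h.symm)
  rcases hac with h | h | h | h
  · exact Or.inl h
  · exact absurd ((descendingRoute_of_into (Or.inr (hs hbc))).trans
      (descendingRoute_of_into (Or.inr (hs hab)))) (hG.no_semidirected_cycle a c h)
  · exact absurd ((descendingRoute_of_into (Or.inr hab)).trans
      (descendingRoute_of_into (Or.inr hbc))) (hG.no_semidirected_cycle c a h)
  · exact Or.inr h

lemma undir_of_undir_undir (hG : G.IsMAMP) {a b c : V} (hab : G.undir.Adj a b)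
    (hbc : G.undir.Adj b c) (hac : G.skeleton.Adj a c) : G.undir.Adj a c := by
  rcases undir_or_bidir_of_into hG (Or.inl hab) (Or.inl hbc) hac with h | h
  · exact h
  · exact absurd (hbc.symm.reachable.trans hab.symm.reachable) (hG.no_bidirected_cycle a c h)

lemma bidir_of_undir_bidir (hG : G.IsMAMP) {a b c : V} (hab : G.undir.Adj a b)
    (hbc : G.bidir.Adj b c) (hac : G.skeleton.Adj a c) : G.bidir.Adj a c := by
  rcases undir_or_bidir_of_into hG (Or.inl hab) (Or.inr hbc) hac with h | h
  · exact absurd (h.symm.reachable.trans hab.reachable) (hG.no_bidirected_cycle b c hbc)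
  · exact h

lemma undir_of_bidir (hG : G.IsMAMP) {a b c d : V} (hac : a ≠ c) (hab : G.undir.Adj a b)
    (hbc : G.undir.Adj b c) (hbd : G.bidir.Adj b d) : G.undir.Adj a c :=
  hG.undir_of_spouse a b c hac hab hbc ⟨d, by
    simp only [spouses, Set.mem_ofPred_eq, Set.mem_singleton_iff, exists_eq_left]
    exact ⟨hbd.ne', hbd.symm⟩⟩

end Triangles

/-! ### Interplay of triplexes and non-triplexes on few nodes. -/

section Patterns

lemma TriplexPattern.symm {a b c : V} (h : G.TriplexPattern a b c) : G.TriplexPattern c b a := by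
  rcases h with ⟨h, h'⟩ | ⟨h, h'⟩ | ⟨h, h'⟩
  · exact Or.inl ⟨h', h⟩
  · exact Or.inr (Or.inr ⟨h'.symm, h⟩)
  · exact Or.inr (Or.inl ⟨h', h.symm⟩)

lemma TriplexPattern.into {a b c : V} (h : G.TriplexPattern a b c) : G.Into a b := by
  rcases h with ⟨h | h, h'⟩ | ⟨h | h, h'⟩ | ⟨h, h'⟩ <;> simp [Into, h]

lemma TriplexPattern.into_right {a b c : V} (h : G.TriplexPattern a b c) : G.Into c b :=
  h.symm.into

lemma Into.not_dir {a b : V} (h : G.Into a b) : ¬ G.dir b a := by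
  rcases h with h | h | h <;> intro h'
  · exact G.dir_asymm _ _ h h'
  · exact G.not_undir_of_dir _ _ h' h.symm
  · exact G.not_bidir_of_dir _ _ h' h.symm

lemma Into.adj {a b : V} (h : G.Into a b) : G.skeleton.Adj a b := by
  rcases h with h | h | h <;> simp [skeleton_adj_iff, h]

lemma not_triplexPattern_of_dir {a b c : V} (h : G.dir b c) : ¬ G.TriplexPattern a b c :=
  fun h' => h'.into_right.not_dir h

lemma not_triplexPattern_of_dir_left {a b c : V} (h : G.dir b a) : ¬ G.TriplexPattern a b c :=
  fun h' => h'.into.not_dir h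

/-- A triple of consecutive nodes is of one of three kinds if it is not a triplex. -/
lemma not_triplexPattern_cases {a b c : V} (hab : G.skeleton.Adj a b) (hbc : G.skeleton.Adj b c)
    (h : ¬ G.TriplexPattern a b c) :
    G.dir b a ∨ G.dir b c ∨ (G.undir.Adj a b ∧ G.undir.Adj b c) := by
  have h1 := hbc.symm
  simp only [skeleton_adj_iff, TriplexPattern, ArrowInto] at *
  tauto

/-- The non-triplex at `c` leaves `c → b` or `b - c - q`. The former forces `a → b`; in the latter
`a` has an arrow tip at `c`, and the triangle copies this edge to `a`, `b`. -/
lemma triplexPattern_step (hG : G.IsMAMP) {a b c q : V} (h : G.TriplexPattern a c q)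
    (hn : ¬ G.TriplexPattern b c q) (hbc : G.skeleton.Adj b c) (hab : G.skeleton.Adj a b) :
    G.TriplexPattern a b c := by
  rcases not_triplexPattern_cases hbc h.into_right.adj.symm hn with h1 | h1 | ⟨h1, h2⟩
  · exact Or.inl ⟨Or.inl (dir_of_into_dir hG h.into h1 hab), Or.inl h1⟩
  · exact absurd h1 h.into_right.not_dir
  · have h3 : G.ArrowInto a c := by
      rcases h with h | h | h
      · exact h.1
      · exact h.1
      · rcases h.2 with h4 | h4
        · exact absurd h2.symm (G.not_undir_of_dir _ _ h4)
        · exact absurd h4 (G.not_bidir_of_undir _ _ h2.symm)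
    refine Or.inr (Or.inl ⟨?_, h1⟩)
    rcases h3 with h3 | h3
    · exact Or.inl (dir_of_dir_into hG h3 (Or.inr (Or.inl h1.symm)) hab)
    · exact Or.inr (bidir_of_undir_bidir hG h1 h3.symm hab.symm).symm

/-- The critical case is `p - a - c`: then `b` has an arrow tip at `a`, and it cannot be a spouse of
`a`, as (C3) would join `p` to `c`. -/
lemma dir_of_triplexPattern (hG : G.IsMAMP) {p a b c : V} (h : G.TriplexPattern p a b)
    (hn : ¬ G.TriplexPattern p a c) (hpc : ¬ G.skeleton.Adj p c) (hpc' : p ≠ c)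
    (hac : G.skeleton.Adj a c) (hbc : G.skeleton.Adj b c) : G.dir b c := by
  rcases not_triplexPattern_cases h.into.adj hac hn with h1 | h1 | ⟨h1, h2⟩
  · exact absurd h1 h.into.not_dir
  · exact dir_of_into_dir hG h.into_right h1 hbc
  · have h3 : G.ArrowInto b a := by
      rcases h with h | h | h
      · exact h.2
      · rcases h.1 with h4 | h4
        · exact absurd h1 (G.not_undir_of_dir _ _ h4)
        · exact absurd h4 (G.not_bidir_of_undir _ _ h1)
      · exact h.2
    rcases h3 with h3 | h3
    · exact dir_of_dir_into hG h3 (Or.inr (Or.inl h2)) hbc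
    · exact absurd (Or.inl (undir_of_bidir hG hpc' h1 h2 h3.symm)) hpc

lemma dir_of_triplexPattern_of_triplexPattern (hG : G.IsMAMP) {p a b q : V}
    (h : G.TriplexPattern p a b) (h' : G.TriplexPattern b a q)
    (hn : ¬ G.TriplexPattern p a q) (hpq : ¬ G.skeleton.Adj p q) (hpq' : p ≠ q) : G.dir b a := by
  rcases not_triplexPattern_cases h.into.adj h'.into_right.adj.symm hn with h1 | h1 | ⟨h1, h2⟩
  · exact absurd h1 h.into.not_dir
  · exact absurd h1 h'.into_right.not_dir
  · have h3 : G.ArrowInto b a := by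
      rcases h with h | h | h
      · exact h.2
      · rcases h.1 with h4 | h4
        · exact absurd h1 (G.not_undir_of_dir _ _ h4)
        · exact absurd h4 (G.not_bidir_of_undir _ _ h1)
      · exact h.2
    rcases h3 with h3 | h3
    · exact h3
    · exact absurd (Or.inl (undir_of_bidir hG hpq' h1 h2 h3.symm)) hpq

lemma false_of_bidir_of_into (hG : G.IsMAMP) {p a b c q : V}
    (h : G.TriplexPattern p a b) (h' : G.TriplexPattern b c q)
    (hn : ¬ G.TriplexPattern p a q) (hpq : ¬ G.skeleton.Adj p q)
    (hpq' : p ≠ q) (hqa : G.skeleton.Adj q a) (hqc : G.skeleton.Adj q c)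
    (hab : G.bidir.Adj a b) (hcb : G.Into c b) : False := by
  rcases not_triplexPattern_cases h.into.adj hqa.symm hn with h1 | h1 | ⟨h1, h2⟩
  · exact h.into.not_dir h1
  · exact h'.into_right.not_dir (dir_of_descendingRoute hG ((descendingRoute_of_into hcb).trans
      (descendingRoute_of_into (Or.inr (Or.inr hab.symm)))) h1 .refl hqc.symm)
  · exact hpq (Or.inl (undir_of_bidir hG hpq' h1 h2 hab))

/-- The triplexes at `a` and `c` exclude `a → b` and `c → b`, so a triplex at `b` would make `a` or
`c` a spouse of `b`. If it is `a`, then `p - a - q` violates (C3) and `a → q` closes a semidirected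
cycle through `c` and `b`; the other case is its mirror image. -/
lemma not_triplexPattern_of_spouse (hG : G.IsMAMP) {p a b c q : V}
    (h : G.TriplexPattern p a b) (h' : G.TriplexPattern b c q) (hn : ¬ G.TriplexPattern p a q)
    (hn' : ¬ G.TriplexPattern p c q) (hpq : ¬ G.skeleton.Adj p q) (hpq' : p ≠ q)
    (hpc : G.skeleton.Adj p c) (hqa : G.skeleton.Adj q a) : ¬ G.TriplexPattern a b c := by
  intro ht
  have hab : G.undir.Adj a b ∨ G.bidir.Adj a b := by
    rcases ht.into with h1 | h1 | h1
    · exact absurd h1 h.into_right.not_dir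
    · exact Or.inl h1
    · exact Or.inr h1
  have hcb : G.undir.Adj c b ∨ G.bidir.Adj c b := by
    rcases ht.into_right with h1 | h1 | h1
    · exact absurd h1 h'.into.not_dir
    · exact Or.inl h1
    · exact Or.inr h1
  have : G.bidir.Adj a b ∨ G.bidir.Adj c b := by
    rcases ht with ⟨h1 | h1, -⟩ | ⟨h1 | h1, -⟩ | ⟨-, h1 | h1⟩
    · exact absurd h1 h.into_right.not_dir
    · exact Or.inl h1
    · exact absurd h1 h.into_right.not_dir
    · exact Or.inl h1
    · exact absurd h1 h'.into.not_dir
    · exact Or.inr h1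
  rcases this with h1 | h1
  · exact false_of_bidir_of_into hG h h' hn hpq hpq' hqa h'.into_right.adj
      h1 (Or.inr hcb)
  · exact false_of_bidir_of_into hG h'.symm h.symm (fun h => hn' h.symm)
      (fun h => hpq h.symm) hpq'.symm hpc h.into.adj h1 (Or.inr hab)

lemma dir_or_undir_of_triplexPattern (hG : G.IsMAMP) {a b c d : V}
    (h : G.TriplexPattern a b c) (hn : ¬ G.TriplexPattern c b d) (hcd : ¬ G.skeleton.Adj c d)
    (hcd' : c ≠ d) (had : G.skeleton.Adj a d) (hbd : G.skeleton.Adj b d) :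
    G.dir b d ∨ (G.dir a b ∧ G.dir a d ∧ G.undir.Adj b c ∧ G.undir.Adj b d) := by
  rcases not_triplexPattern_cases h.into_right.adj hbd hn with h1 | h1 | ⟨h1, h2⟩
  · exact absurd h1 h.into_right.not_dir
  · exact Or.inl h1
  · right
    have h3 : G.ArrowInto a b := by
      rcases h with h | h | h
      · exact h.1
      · exact h.1
      · rcases h.2 with h4 | h4
        · exact absurd h1 (G.not_undir_of_dir _ _ h4)
        · exact absurd h4 (G.not_bidir_of_undir _ _ h1)
    rcases h3 with h3 | h3
    · exact ⟨h3, dir_of_dir_into hG h3 (Or.inr (Or.inl h2)) had, h1.symm, h2⟩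
    · exact absurd (Or.inl (undir_of_bidir hG hcd' h1 h2 h3.symm)) hcd

lemma dir_of_not_triplexPattern_of_not_triplexPattern {a b c d : V} (h : G.TriplexPattern a b c)
    (hn : ¬ G.TriplexPattern a b d) (hn' : ¬ G.TriplexPattern c b d) (hbd : G.skeleton.Adj b d) :
    G.dir b d := by
  rcases not_triplexPattern_cases h.into.adj hbd hn with h1 | h1 | ⟨h1, h2⟩
  · exact absurd h1 h.into.not_dir
  · exact h1
  · rcases not_triplexPattern_cases h.into_right.adj hbd hn' with h3 | h3 | ⟨h3, -⟩
    · exact absurd h3 h.into_right.not_dir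
    · exact h3
    · rcases h with ⟨h | h, -⟩ | ⟨h | h, -⟩ | ⟨-, h | h⟩
      · exact absurd h1 (G.not_undir_of_dir _ _ h)
      · exact absurd h (G.not_bidir_of_undir _ _ h1)
      · exact absurd h1 (G.not_undir_of_dir _ _ h)
      · exact absurd h (G.not_bidir_of_undir _ _ h1)
      · exact absurd h3 (G.not_undir_of_dir _ _ h)
      · exact absurd h (G.not_bidir_of_undir _ _ h3)

lemma dir_of_dir_of_not_triplexPattern {a b c : V} (hab : G.dir a b) (hbc : G.skeleton.Adj b c)
    (hn : ¬ G.TriplexPattern a b c) : G.dir b c := by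
  rcases not_triplexPattern_cases (Or.inr (Or.inl hab)) hbc hn with h1 | h1 | ⟨h1, -⟩
  · exact absurd h1 (G.dir_asymm _ _ hab)
  · exact h1
  · exact absurd h1 (G.not_undir_of_dir _ _ hab)

end Patterns

end MixedGraph

/-! ### Edge marks and weighted open routes. -/

namespace MixedGraph

variable {V : Type*} {G : MixedGraph V}

/-- The mark of an edge at one of its ends. -/
inductive Mark
  | tail
  | line
  | head

open Mark

/-- There is an edge between `a` and `b` with the given marks at `a` and at `b`. -/
def Edge (G : MixedGraph V) : Mark → V → V → Mark → Prop
  | tail, a, b, head => G.dir a b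
  | head, a, b, tail => G.dir b a
  | line, a, b, line => G.undir.Adj a b
  | head, a, b, head => G.bidir.Adj a b
  | _, _, _, _ => False

/-- Two marks that make a node into a triplex node. -/
def Mark.Triplex : Mark → Mark → Prop
  | head, head => True
  | head, line => True
  | line, head => True
  | _, _ => False

lemma Mark.Triplex.symm {μ ν : Mark} (h : μ.Triplex ν) : ν.Triplex μ := by
  cases μ <;> cases ν <;> simp_all [Mark.Triplex]

lemma Edge.symm {a b : V} {μ ν : Mark} (h : G.Edge μ a b ν) : G.Edge ν b a μ := by
  cases μ <;> cases ν <;> simp_all [Edge, SimpleGraph.adj_comm]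

lemma Edge.adj {a b : V} {μ ν : Mark} (h : G.Edge μ a b ν) : G.skeleton.Adj a b := by
  cases μ <;> cases ν <;> simp_all [Edge, skeleton_adj_iff]

lemma Edge.unique {a b : V} {μ ν μ' ν' : Mark} (h : G.Edge μ a b ν) (h' : G.Edge μ' a b ν') :
    μ = μ' ∧ ν = ν' := by
  have h1 := G.dir_asymm a b
  have h2 := G.not_undir_of_dir a b
  have h3 := G.not_bidir_of_dir a b
  have h4 := G.not_undir_of_dir b a
  have h5 := G.not_bidir_of_dir b a
  have h6 := G.not_bidir_of_undir a b
  rw [SimpleGraph.adj_comm] at h4 h5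
  cases μ <;> cases ν <;> simp only [Edge] at h <;> cases μ' <;> cases ν' <;>
    simp only [Edge] at h' <;> simp <;> tauto

lemma exists_edge {a b : V} (h : G.skeleton.Adj a b) : ∃ μ ν, G.Edge μ a b ν := by
  rcases h with h | h | h | h
  · exact ⟨line, line, h⟩
  · exact ⟨tail, head, h⟩
  · exact ⟨head, tail, h⟩
  · exact ⟨head, head, h⟩

lemma Edge.irrefl {a : V} {μ ν : Mark} (h : G.Edge μ a a ν) : False :=
  G.skeleton.irrefl h.adj

lemma triplexPattern_iff {a b c : V} {μ ν ρ σ : Mark} (h : G.Edge μ a b ν) (h' : G.Edge ρ b c σ) :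
    G.TriplexPattern a b c ↔ ν.Triplex ρ := by
  have h1 := G.dir_asymm a b
  have h2 := G.not_undir_of_dir a b
  have h3 := G.not_bidir_of_dir a b
  have h4 := G.not_undir_of_dir b a
  have h5 := G.not_bidir_of_dir b a
  have h6 := G.not_bidir_of_undir a b
  have k1 := G.dir_asymm c b
  have k2 := G.not_undir_of_dir c b
  have k3 := G.not_bidir_of_dir c b
  have k4 := G.not_undir_of_dir b c
  have k5 := G.not_bidir_of_dir b c
  have k6 := G.not_bidir_of_undir b c
  have e1 := G.undir.adj_comm a b
  have e2 := G.undir.adj_comm c b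
  have e3 := G.bidir.adj_comm a b
  have e4 := G.bidir.adj_comm c b
  cases μ <;> cases ν <;> simp only [Edge] at h <;> cases ρ <;> cases σ <;>
    simp only [Edge] at h' <;> simp only [Mark.Triplex, TriplexPattern, ArrowInto] <;> grind

/-- The nodes from which a node of `Z` can be reached along directed edges. -/
def An (G : MixedGraph V) (Z : Set V) : Set V :=
  {a | ∃ b ∈ Z, G.StrictlyDescendingRoute a b}

lemma subset_An {Z : Set V} : Z ⊆ G.An Z := fun a ha => ⟨a, ha, .refl⟩

lemma mem_An_of_dir {Z : Set V} {a b : V} (h : G.dir a b) (hb : b ∈ G.An Z) : a ∈ G.An Z :=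
  let ⟨z, hz, hbz⟩ := hb
  ⟨z, hz, .head h hbz⟩

lemma An_eq (Z : Set V) : G.An Z = Z ∪ G.strictAscendants Z := by
  ext a
  constructor
  · rintro ⟨b, hb, hab⟩
    by_cases ha : a ∈ Z
    · exact Or.inl ha
    · exact Or.inr ⟨ha, b, hb, hab⟩
  · rintro (ha | ⟨-, b, hb, hab⟩)
    · exact subset_An ha
    · exact ⟨b, hb, hab⟩

/-- A node may be passed from an edge to another one that have the given marks at the node.
The nodes of `E` are exempted from being outside `Z` if both edges are undirected. -/
def Passes (G : MixedGraph V) (Z E : Set V) (μ ν : Mark) (b : V) : Prop :=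
  (μ.Triplex ν → b ∈ G.An Z) ∧
    (¬ μ.Triplex ν → b ∉ Z ∨ (μ = line ∧ ν = line ∧ b ∈ E))

variable {Z E : Set V} {w : V → ℕ} {x y : V}

lemma Passes.symm {μ ν : Mark} {b : V} (h : G.Passes Z E μ ν b) : G.Passes Z E ν μ b :=
  ⟨fun ht => h.1 ht.symm, fun ht => (h.2 fun h' => ht h'.symm).imp id
    fun ⟨h1, h2, h3⟩ => ⟨h2, h1, h3⟩⟩

/-- There is an open route of weight `k` from `x` to `a` that may be continued
along an edge that has the given mark at `a`. -/
inductive Exit (G : MixedGraph V) (Z E : Set V) (w : V → ℕ) (x : V) : ℕ → V → Mark → Prop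
  | start (ν : Mark) : Exit G Z E w x (w x) x ν
  | step {k : ℕ} {a b : V} {μ ν ρ : Mark} : Exit G Z E w x k a μ → G.Edge μ a b ν →
      G.Passes Z E ν ρ b → Exit G Z E w x (k + w b) b ρ

lemma Exit.change {k : ℕ} {a : V} {μ μ' : Mark} (h : Exit G Z E w x k a μ)
    (hp : ∀ ν, G.Passes Z E ν μ a → G.Passes Z E ν μ' a) : Exit G Z E w x k a μ' := by
  cases h with
  | start => exact .start _
  | step h e p => exact .step h e (hp _ p)

/-- Two open routes that end in the same node can be joined there. -/
lemma Exit.glue {k l : ℕ} {a : V} {μ μ' : Mark} (h : Exit G Z E w x k a μ)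
    (h' : Exit G Z E w y l a μ') (hxy : x ≠ y)
    (hp : ∀ ν ν', G.Passes Z E ν μ a → G.Passes Z E ν' μ' a → G.Passes Z E ν ν' a) :
    ∃ m n b c ρ σ, Exit G Z E w x m b ρ ∧ G.Edge ρ b c σ ∧ Exit G Z E w y n c σ ∧
      m + n + w a = k + l := by
  cases h with
  | start =>
    cases h' with
    | start => exact absurd rfl hxy
    | step h' e' p' => exact ⟨_, _, _, _, _, _, .start _, e'.symm, h', by omega⟩
  | step h e p =>
    cases h' with
    | start => exact ⟨_, _, _, _, _, _, h, e, .start _, by omega⟩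
    | step h' e' p' => exact ⟨_, _, _, _, _, _, h, e, .step h' e' (hp _ _ p p').symm, by omega⟩

section Change

variable {k : ℕ} {a : V} {μ : Mark}

lemma Exit.to_tail (h : Exit G Z E w x k a μ) (ha : a ∉ Z) : Exit G Z E w x k a tail :=
  h.change fun ν _ => ⟨fun ht => by cases ν <;> exact ht.elim, fun _ => Or.inl ha⟩

lemma Exit.head_of_line (h : Exit G Z E w x k a line) (ha : a ∈ G.An Z) :
    Exit G Z E w x k a head :=
  h.change fun ν hν => ⟨fun _ => ha, fun ht => by
    cases ν
    · simpa [Mark.Triplex] using hν.2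
    all_goals simp [Mark.Triplex] at ht⟩

lemma Exit.line_of_head (h : Exit G Z E w x k a head) (ha : a ∉ Z) :
    Exit G Z E w x k a line :=
  h.change fun ν hν => ⟨fun ht => by
    cases ν
    · simp [Mark.Triplex] at ht
    · simp [Mark.Triplex] at ht
    · exact hν.1 trivial, fun _ => Or.inl ha⟩

lemma Exit.of_tail (h : Exit G Z E w x k a tail) (ha : a ∈ G.An Z) :
    Exit G Z E w x k a μ :=
  h.change fun ν hν => ⟨fun _ => ha, fun _ => by
    have := hν.2 (by cases ν <;> simp [Mark.Triplex])
    exact Or.inl (by simpa using this)⟩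

end Change

section Steps

variable {k : ℕ} {a b : V}

lemma Exit.step_dir_line (h : Exit G Z E w x k a tail) (e : G.dir a b) (hb : b ∈ G.An Z) :
    Exit G Z E w x (k + w b) b line :=
  h.step (show G.Edge tail a b head from e) ⟨fun _ => hb, fun h => absurd trivial h⟩

lemma Exit.step_dir_head (h : Exit G Z E w x k a tail) (e : G.dir a b) (hb : b ∈ G.An Z) :
    Exit G Z E w x (k + w b) b head :=
  h.step (show G.Edge tail a b head from e) ⟨fun _ => hb, fun h => absurd trivial h⟩

lemma Exit.step_undir_head (h : Exit G Z E w x k a line) (e : G.undir.Adj a b)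
    (hb : b ∈ G.An Z) : Exit G Z E w x (k + w b) b head :=
  h.step (show G.Edge line a b line from e) ⟨fun _ => hb, fun h => absurd trivial h⟩

lemma Exit.step_undir_line (h : Exit G Z E w x k a line) (e : G.undir.Adj a b)
    (hb : b ∉ Z) : Exit G Z E w x (k + w b) b line :=
  h.step (show G.Edge line a b line from e) ⟨fun h => h.elim, fun _ => Or.inl hb⟩

end Steps

end MixedGraph

/-! ### A lightest open route has the same triplexes in both graphs. -/

namespace MixedGraph

variable {V : Type*} {G H : MixedGraph V}

open Mark

/-- The number `N` is a lower bound for the weights of the open routes between `x` and `y` in `G`,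
and `G` and `H` are triplex equivalent. -/
structure Setting (G H : MixedGraph V) (Z : Set V) (w : V → ℕ) (x y : V) (N : ℕ) : Prop where
  mampG : G.IsMAMP
  mampH : H.IsMAMP
  adj : ∀ a b, H.skeleton.Adj a b ↔ G.skeleton.Adj a b
  triplex : ∀ a b c, a ≠ c → ¬ G.skeleton.Adj a c → G.skeleton.Adj a b → G.skeleton.Adj b c →
    (H.TriplexPattern a b c ↔ G.TriplexPattern a b c)
  pos : ∀ v, 0 < w v
  lt : ∀ a b, G.dir a b → w b < w a
  ne : x ≠ y
  left : x ∉ Z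
  right : y ∉ Z
  min : ∀ k l a b μ ν, Exit G Z ∅ w x k a μ → G.Edge μ a b ν → Exit G Z ∅ w y l b ν → N ≤ k + l

/-- The nodes `a`, `b`, `c` are consecutive in an open route of weight `N`. -/
structure Mid (G : MixedGraph V) (Z : Set V) (w : V → ℕ) (x y : V) (N k : ℕ) (a : V)
    (μ ν : Mark) (b : V) (ρ σ : Mark) (c : V) (l : ℕ) : Prop where
  left : Exit G Z ∅ w x k a μ
  edge : G.Edge μ a b ν
  passes : G.Passes Z ∅ ν ρ b
  edge' : G.Edge ρ b c σ
  right : Exit G Z ∅ w y l c σ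
  cost : k + w b + l = N

variable {Z : Set V} {w : V → ℕ} {x y : V} {N k l : ℕ} {a b c : V} {μ ν ρ σ : Mark}

lemma Setting.symm (S : Setting G H Z w x y N) : Setting G H Z w y x N where
  mampG := S.mampG
  mampH := S.mampH
  adj := S.adj
  triplex := S.triplex
  pos := S.pos
  lt := S.lt
  ne := S.ne.symm
  left := S.right
  right := S.left
  min k l a b μ ν h e h' := by
    have := S.min l k b a ν μ h' e.symm h
    omega

lemma Mid.symm (M : Mid G Z w x y N k a μ ν b ρ σ c l) : Mid G Z w y x N l c σ ρ b ν μ a k where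
  left := M.right
  edge := M.edge'.symm
  passes := M.passes.symm
  edge' := M.edge.symm
  right := M.left
  cost := by have := M.cost; omega

lemma passes_empty_iff : G.Passes Z ∅ μ ν b ↔ (μ.Triplex ν → b ∈ G.An Z) ∧
    (¬ μ.Triplex ν → b ∉ Z) := by
  simp [Passes]

lemma Setting.glue_le (S : Setting G H Z w x y N) (h : Exit G Z ∅ w x k a μ)
    (h' : Exit G Z ∅ w y l a σ)
    (hp : ∀ ν ν', G.Passes Z ∅ ν μ a → G.Passes Z ∅ ν' σ a → G.Passes Z ∅ ν ν' a) :
    N + w a ≤ k + l := by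
  obtain ⟨m, n, b, c, ρ, σ, h1, h2, h3, h4⟩ := h.glue h' S.ne hp
  have := S.min _ _ _ _ _ _ h1 h2 h3
  omega

/-- Two ends marked `head` have no such lemma: if both halves arrive at a node of `Z` by undirected
edges, the junction is blocked. This is the only obstruction. -/
lemma Setting.glue_line_line (S : Setting G H Z w x y N) (h : Exit G Z ∅ w x k a line)
    (h' : Exit G Z ∅ w y l a line) : N + w a ≤ k + l := by
  refine S.glue_le h h' fun ν ν' => ?_
  simp only [passes_empty_iff]
  cases ν <;> cases ν' <;> simp [Mark.Triplex] <;> tauto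

lemma Setting.glue_line_head (S : Setting G H Z w x y N) (h : Exit G Z ∅ w x k a line)
    (h' : Exit G Z ∅ w y l a head) : N + w a ≤ k + l := by
  refine S.glue_le h h' fun ν ν' => ?_
  simp only [passes_empty_iff]
  cases ν <;> cases ν' <;> simp [Mark.Triplex] <;> tauto

lemma Setting.glue_head_line (S : Setting G H Z w x y N) (h : Exit G Z ∅ w x k a head)
    (h' : Exit G Z ∅ w y l a line) : N + w a ≤ k + l := by
  have := S.symm.glue_line_head h' h
  omega

/-- Only a node of `Z` reached by an undirected edge may be left by an edge with an arrow tip there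
but not by an undirected one. `Exit.exists_line_of_line` is the dual, for nodes that are not
ancestors of `Z`. -/
lemma Exit.exists_line_of_head (h : Exit G Z ∅ w x k a head) (hx : x ∉ Z) :
    Exit G Z ∅ w x k a line ∨
      (a ∈ Z ∧ ∃ k' p, Exit G Z ∅ w x k' p line ∧ G.undir.Adj p a ∧ k = k' + w a) := by
  by_cases ha : a ∈ Z
  · cases h with
    | start => exact absurd ha hx
    | @step k' p _ α β _ h e pp =>
      rw [passes_empty_iff] at pp
      cases β
      · exact absurd ha (pp.2 (by simp [Mark.Triplex]))
      · cases α <;> first | exact e.elim | exact Or.inr ⟨ha, k', p, h, e, rfl⟩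
      · exact Or.inl (.step h e (passes_empty_iff.2 ⟨fun _ => subset_An ha,
          fun h => absurd trivial h⟩))
  · exact Or.inl (h.line_of_head ha)

lemma Exit.exists_line_of_line (h : Exit G Z ∅ w x k a line) :
    Exit G Z ∅ w x k a head ∨
      (a ∉ G.An Z ∧ ∃ k' p, Exit G Z ∅ w x k' p line ∧ G.undir.Adj p a ∧ k = k' + w a) := by
  by_cases ha : a ∈ G.An Z
  · exact Or.inl (h.head_of_line ha)
  · cases h with
    | start => exact Or.inl (.start _)
    | @step k' p _ α β _ h e pp =>
      rw [passes_empty_iff] at pp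
      cases β
      · exact Or.inl (.step h e (passes_empty_iff.2 ⟨fun h => h.elim,
          fun _ => pp.2 (by simp [Mark.Triplex])⟩))
      · cases α <;> first | exact e.elim | exact Or.inr ⟨ha, k', p, h, e, rfl⟩
      · exact absurd (pp.1 trivial) ha

lemma not_triplexPattern_of_undir (h : G.undir.Adj a b) (h' : G.undir.Adj b c) :
    ¬ G.TriplexPattern a b c := by
  rw [triplexPattern_iff (μ := line) (ν := line) (ρ := line) (σ := line) h h']
  simp [Mark.Triplex]

/-- A lightest route backtracks only as `p - a ← b → a - q` with `a` in `Z`. Otherwise its halves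
could be joined at `a` or, when `a ↔ b`, at the node `p = q` or by the edge `p - q` that (C3)
provides. -/
lemma Mid.exists_of_eq (S : Setting G H Z w x y N) (M : Mid G Z w x y N k a μ ν b ρ σ a l) :
    G.dir b a ∧ a ∈ Z ∧ (∃ k' p, Exit G Z ∅ w x k' p line ∧ G.undir.Adj p a ∧ k = k' + w a) ∧
      ∃ l' q, Exit G Z ∅ w y l' q line ∧ G.undir.Adj q a ∧ l = l' + w a := by
  obtain ⟨hl, e, p, e', hr, hc⟩ := M
  obtain ⟨rfl, rfl⟩ := e.unique e'.symm
  have hb := S.pos b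
  cases μ
  · cases ν <;> try exact e.elim
    have hab : G.dir a b := e
    have ha : a ∈ G.An Z := mem_An_of_dir hab (p.1 trivial)
    have := S.glue_line_line (hl.of_tail ha) (hr.of_tail ha)
    omega
  · have := S.glue_line_line hl hr
    omega
  · rcases hl.exists_line_of_head S.left with h | ⟨ha, k', p', hp, hpa, rfl⟩
    · have := S.glue_line_head h hr
      omega
    rcases hr.exists_line_of_head S.right with h | ⟨-, l', q, hq, hqa, rfl⟩
    · have := S.glue_head_line hl h
      omega
    refine ⟨?_, ha, ⟨k', p', hp, hpa, rfl⟩, l', q, hq, hqa, rfl⟩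
    cases ν <;> try exact e.elim
    · exact e
    · exfalso
      by_cases hpq : p' = q
      · subst hpq
        have := S.glue_line_line hp hq
        omega
      · have := S.min _ _ _ _ _ line hp (undir_of_bidir S.mampG hpq hpa hqa.symm e) hq
        omega

/-- The node `a` stays fixed while `b - c` slides along an undirected run of the route. When `a → c`
is not yet a shortcut, the run goes on to some `q`; the triplex `a, c, q` is known by induction, and
the unshielded non-triplex `b, c, q` carries it back to `b` by `triplexPattern_step`. -/
lemma Setting.triplexPattern_of_run (S : Setting G H Z w x y N) (hr : Exit G Z ∅ w y l c line)
    {k' : ℕ} (hl : Exit G Z ∅ w x k' b line) (hbc : G.undir.Adj b c) (hk : k' + l = N)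
    (ha : Exit G Z ∅ w x k a tail) (hab : G.dir a b) (hkk : k < k') :
    H.TriplexPattern a b c := by
  induction l using Nat.strong_induction_on generalizing b c k' with
  | _ l ih =>
  have hac : a ≠ c := by
    rintro rfl
    exact G.not_undir_of_dir _ _ hab hbc.symm
  by_cases hadj : G.skeleton.Adj a c
  · have hac' : G.dir a c := dir_of_dir_into S.mampG hab (Or.inr (Or.inl hbc)) hadj
    rcases hr.exists_line_of_line with h | ⟨hc, l', q, hq, hqc, rfl⟩
    · have := S.min _ _ _ _ _ _ ha (show G.Edge tail a c head from hac') h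
      omega
    · have hw := S.pos c
      have hpass : G.Passes Z ∅ line line c :=
        passes_empty_iff.2 ⟨fun h => h.elim, fun _ h => hc (subset_An h)⟩
      have h1 := ih l' (by omega) hq (.step hl (show G.Edge line b c line from hbc) hpass)
        hqc.symm (by omega) hac' (by omega)
      have M : Mid G Z w x y N k' b line line c line line q l' :=
        ⟨hl, hbc, hpass, hqc.symm, hq, by omega⟩
      have hbq : b ≠ q := by
        rintro rfl
        exact G.not_undir_of_dir _ _ (M.exists_of_eq S).1 hbc.symm
      have hbq' : ¬ G.skeleton.Adj b q := by
        intro h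
        have := S.min _ _ _ _ _ line hl (undir_of_undir_undir S.mampG hbc hqc.symm h) hq
        omega
      refine triplexPattern_step S.mampH h1 (fun h => ?_) ((S.adj _ _).2 (Or.inl hbc))
        ((S.adj _ _).2 (Or.inr (Or.inl hab)))
      exact not_triplexPattern_of_undir hbc hqc.symm
        ((S.triplex _ _ _ hbq hbq' (Or.inl hbc) (Or.inl hqc.symm)).1 h)
  · exact (S.triplex _ _ _ hac hadj (Or.inr (Or.inl hab)) (Or.inl hbc)).2
      (Or.inr (Or.inl ⟨Or.inl hab, hbc⟩))

/-- Both `a` and `c` have the spouse `b`, so (C3) shortens the undirected run through them from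
either side, and each shortening is lighter than `N`. -/
lemma Setting.false_of_spouses (S : Setting G H Z w x y N) {p : V} {k' : ℕ}
    (hp : Exit G Z ∅ w x k' p line) (hpa : G.undir.Adj p a) (hab : G.bidir.Adj a b)
    (hbc : G.bidir.Adj b c) (hac : G.undir.Adj a c) (hr : Exit G Z ∅ w y l c head)
    (hN : k' + w a + w b + l = N) : False := by
  have ha := S.pos a
  by_cases hpc : p = c
  · subst hpc
    have := S.glue_line_head hp hr
    omega
  · have hpc' : G.undir.Adj p c := undir_of_bidir S.mampG hpc hpa hac hab
    rcases hr.exists_line_of_head S.right with h | ⟨-, l', q, hq, hqc, rfl⟩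
    · have := S.min _ _ _ _ _ line hp hpc' h
      omega
    · by_cases hpq : p = q
      · subst hpq
        have := S.glue_line_line hp hq
        omega
      · have := S.min _ _ _ _ _ line hp
          (undir_of_bidir S.mampG hpq hpc' hqc.symm hbc.symm) hq
        omega

lemma Setting.false_of_bidir_undir (S : Setting G H Z w x y N)
    (hl : Exit G Z ∅ w x k a head) (hl' : Exit G Z ∅ w x (k + w b) b line)
    (hbc : G.undir.Adj b c) (hac : G.bidir.Adj a c) (hr : Exit G Z ∅ w y l c line)
    (hN : k + w b + l = N) : False := by
  have hb := S.pos b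
  have hc := S.pos c
  rcases hr.exists_line_of_line with h | ⟨-, l', q, hq, hqc, rfl⟩
  · have := S.min _ _ _ _ _ head hl hac h
    omega
  · by_cases hbq : b = q
    · subst hbq
      have := S.glue_line_line hl' hq
      omega
    · have := S.min _ _ _ _ _ line hl'
        (undir_of_bidir S.mampG hbq hbc hqc.symm hac.symm) hq
      omega

/-- A triplex of a lightest open route in `G` is a triplex in `H`. -/
lemma Mid.triplexPattern (S : Setting G H Z w x y N) (M : Mid G Z w x y N k a μ ν b ρ σ c l)
    (ht : ν.Triplex ρ) : H.TriplexPattern a b c := by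
  have htG : G.TriplexPattern a b c := (triplexPattern_iff M.edge M.edge').2 ht
  have hac : a ≠ c := by
    rintro rfl
    exact htG.into.not_dir (M.exists_of_eq S).1
  by_cases hadj : G.skeleton.Adj a c
  swap
  · exact (S.triplex _ _ _ hac hadj M.edge.adj M.edge'.adj).2 htG
  have M' := M.symm
  obtain ⟨hl, e, p, e', hr, hc⟩ := M
  have hbA : b ∈ G.An Z := p.1 ht
  have hb := S.pos b
  have hleft : Exit G Z ∅ w x (k + w b) b ρ := .step hl e p
  have hright : Exit G Z ∅ w y (l + w b) b ν := .step hr e'.symm p.symm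
  -- The triplex is shielded. Only `a → b - c` and its mirror image can occur on a lightest route;
  -- each other combination of edges admits a shortcut.
  cases μ <;> cases ν <;> (try exact e.elim) <;> (try exact ht.elim) <;>
    cases ρ <;> (try exact ht.elim) <;> cases σ <;> (try exact e'.elim)
  · exact S.triplexPattern_of_run hr hleft e' hc hl e (by omega)
  · obtain ⟨α, β, h⟩ := exists_edge hadj
    have := S.min _ _ _ _ _ _ (hl.of_tail (mem_An_of_dir e hbA)) h
      (hr.of_tail (mem_An_of_dir e' hbA))
    omega
  · have h := dir_of_dir_into S.mampG e (Or.inr (Or.inr e')) hadj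
    have := S.min _ _ _ _ _ head hl h hr
    omega
  · exact (S.symm.triplexPattern_of_run hl hright e.symm (by omega) hr e' (by omega)).symm
  · exact (S.symm.false_of_bidir_undir hr hright e.symm
      (bidir_of_undir_bidir S.mampG e e' hadj).symm hl (by omega)).elim
  · exact (S.false_of_bidir_undir hl hleft e'
      (bidir_of_undir_bidir S.mampG e'.symm e.symm hadj.symm).symm hr (by omega)).elim
  · have h := dir_of_dir_into S.mampG e' (Or.inr (Or.inr e.symm)) hadj.symm
    have := S.min _ _ _ _ _ tail hl h hr
    omega
  · exfalso
    rcases undir_or_bidir_of_into S.mampG (Or.inr e) (Or.inr e') hadj with h | h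
    · rcases hl.exists_line_of_head S.left with h1 | ⟨-, k', p', hp, hpa, rfl⟩
      · rcases hr.exists_line_of_head S.right with h2 | ⟨-, l', q, hq, hqc, rfl⟩
        · have := S.min _ _ _ _ _ line h1 h h2
          omega
        · exact S.symm.false_of_spouses hq hqc e'.symm e.symm h.symm hl (by omega)
      · exact S.false_of_spouses hp hpa e e' h hr (by omega)
    · have := S.min _ _ _ _ _ head hl h hr
      omega

/-- If the last two nodes of an initial segment of a lightest open route are adjacent to `d`
and the former is a parent of it, then the latter is a parent of `d` in `H` or
the segment can be cut short so as to continue to `d`. -/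
lemma Setting.dir_or_exists_exit (S : Setting G H Z w x y N) (hl : Exit G Z ∅ w x k a μ)
    (e : G.Edge μ a b ν) (hr : Exit G Z ∅ w y l b ν) (hN : k + l = N) {d : V}
    (had : G.dir a d) (hbd : G.skeleton.Adj b d) :
    H.dir b d ∨ ∃ k' ≤ k, ∃ u, Exit G Z ∅ w x k' u tail ∧ G.dir u d := by
  induction hl generalizing b ν l with
  | start => exact Or.inr ⟨_, le_rfl, x, .start _, had⟩
  | @step k p a α β ρ h e' pp ih =>
    -- Outside `Z` the route may leave `a` along `a → d` at once. A node of `Z` has to be a triplex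
    -- node, and the search moves back to `p`.
    by_cases ha : a ∈ Z
    · have ht : β.Triplex ρ := by
        by_contra hn
        exact (passes_empty_iff.1 pp).2 hn ha
      have htG := (triplexPattern_iff e' e).2 ht
      have htH := Mid.triplexPattern S ⟨h, e', pp, e, hr, hN⟩ ht
      by_cases hpd : G.skeleton.Adj p d
      · rcases ih e' (.step hr e.symm pp.symm) (by omega)
          (dir_of_into_dir S.mampG htG.into had hpd) (Or.inr (Or.inl had)) with h1 | h1
        · exact Or.inl (dir_of_into_dir S.mampH htH.into_right h1 ((S.adj _ _).2 hbd))
        · obtain ⟨k', hk', h1⟩ := h1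
          exact Or.inr ⟨k', by omega, h1⟩
      · have hpd' : p ≠ d := by
          rintro rfl
          exact htG.into.not_dir had
        refine Or.inl (dir_of_triplexPattern S.mampH htH (fun h1 => ?_)
          (fun h => hpd ((S.adj _ _).1 h)) hpd' ((S.adj _ _).2 (Or.inr (Or.inl had)))
          ((S.adj _ _).2 hbd))
        exact not_triplexPattern_of_dir had
          ((S.triplex _ _ _ hpd' hpd e'.adj (Or.inr (Or.inl had))).1 h1)
    · exact Or.inr ⟨_, le_rfl, a, (Exit.step h e' pp).to_tail ha, had⟩

/-- In a lightest open route, a triplex `p - a ← b` with `a` in `Z` is a triplex in `H`. -/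
lemma Mid.triplexPattern_prev (S : Setting G H Z w x y N)
    (M : Mid G Z w x y N k a μ ν b ρ σ c l) (hba : G.dir b a) (ha : a ∈ Z) {k' : ℕ} {p : V}
    (hp : Exit G Z ∅ w x k' p line) (hpa : G.undir.Adj p a) (hk : k = k' + w a) :
    H.TriplexPattern p a b := by
  obtain ⟨rfl, rfl⟩ := M.edge.unique (show G.Edge head a b tail from hba)
  refine Mid.triplexPattern (ν := line) (μ := line) (ρ := head) (σ := tail) (k := k')
    (l := l + w b) S ⟨hp, hpa, passes_empty_iff.2 ⟨fun _ => subset_An ha,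
      fun h => absurd trivial h⟩, hba, .step M.right M.edge'.symm M.passes.symm, ?_⟩ trivial
  have := M.cost
  omega

/-- If `p` and `c` are not adjacent, the triplex `p, a, b` forces `b → c` in `H`. Otherwise `p - c`
would be a shortcut unless `c` is in `Z` with some `q - c` next. The same alternative for `q` and
`a` leaves `p` and `q` both adjacent to `a` and `c` but not to each other, which is
`not_triplexPattern_of_spouse`. -/
lemma Mid.not_triplexPattern_of_fork (S : Setting G H Z w x y N)
    (M : Mid G Z w x y N k a μ ν b ρ σ c l) (hba : G.dir b a) (hbc : G.dir b c)
    (hac : G.undir.Adj a c) (ha : a ∈ Z) {k' : ℕ} {p : V}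
    (hp : Exit G Z ∅ w x k' p line) (hpa : G.undir.Adj p a) (hk : k = k' + w a) :
    ¬ H.TriplexPattern a b c := by
  have h1 := M.triplexPattern_prev S hba ha hp hpa hk
  obtain ⟨rfl, rfl⟩ := M.edge.unique (show G.Edge head a b tail from hba)
  obtain ⟨rfl, rfl⟩ := M.edge'.unique (show G.Edge tail b c head from hbc)
  have hcost := M.cost
  have hwa := S.pos a
  have hwb := S.pos b
  have hHba : H.skeleton.Adj b a := (S.adj _ _).2 (Or.inr (Or.inl hba))
  have hHbc : H.skeleton.Adj b c := (S.adj _ _).2 (Or.inr (Or.inl hbc))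
  have hHac : H.skeleton.Adj a c := (S.adj _ _).2 (Or.inl hac)
  have hpc : p ≠ c := by
    rintro rfl
    have := S.glue_line_head hp M.right
    omega
  by_cases hpc' : G.skeleton.Adj p c
  swap
  · refine not_triplexPattern_of_dir (dir_of_triplexPattern S.mampH h1 (fun h => ?_)
      (fun h => hpc' ((S.adj _ _).1 h)) hpc hHac hHbc)
    exact not_triplexPattern_of_undir hpa hac
      ((S.triplex _ _ _ hpc hpc' (Or.inl hpa) (Or.inl hac)).1 h)
  have hpcu : G.undir.Adj p c := undir_of_undir_undir S.mampG hpa hac hpc'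
  rcases M.right.exists_line_of_head S.right with h | ⟨hc, l', q, hq, hqc, hl⟩
  · have := S.min _ _ _ _ _ line hp hpcu h
    omega
  have h2 := M.symm.triplexPattern_prev S.symm hbc hc hq hqc hl
  have hqa : q ≠ a := by
    rintro rfl
    have := S.glue_head_line M.left hq
    omega
  by_cases hqa' : G.skeleton.Adj q a
  swap
  · refine not_triplexPattern_of_dir_left (dir_of_triplexPattern S.mampH h2 (fun h => ?_)
      (fun h => hqa' ((S.adj _ _).1 h)) hqa hHac.symm hHba)
    exact not_triplexPattern_of_undir hqc hac.symm
      ((S.triplex _ _ _ hqa hqa' (Or.inl hqc) (Or.inl hac.symm)).1 h)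
  have hqau : G.undir.Adj q a := undir_of_undir_undir S.mampG hqc hac.symm hqa'
  have hpq : p ≠ q := by
    rintro rfl
    have := S.glue_line_line hp hq
    omega
  have hpq' : ¬ G.skeleton.Adj p q := by
    intro h
    have := S.min _ _ _ _ _ line hp (undir_of_undir_undir S.mampG hpcu hqc.symm h) hq
    omega
  refine not_triplexPattern_of_spouse S.mampH h1 h2.symm (fun h => ?_) (fun h => ?_)
    (fun h => hpq' ((S.adj _ _).1 h)) hpq ((S.adj _ _).2 hpc') ((S.adj _ _).2 hqa')
  · exact not_triplexPattern_of_undir hpa hqau.symm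
      ((S.triplex _ _ _ hpq hpq' (Or.inl hpa) (Or.inl hqau.symm)).1 h)
  · exact not_triplexPattern_of_undir hpcu hqc.symm
      ((S.triplex _ _ _ hpq hpq' (Or.inl hpcu) (Or.inl hqc.symm)).1 h)

/-- If `a → c`, either `b → c` persists in `H` or there is a lighter route into `c`. The case `c →
a` is symmetric, `a ↔ c` is itself a shortcut, and `a - c` is the fork `a ← b → c`. -/
lemma Mid.not_triplexPattern_of_dir (S : Setting G H Z w x y N)
    (M : Mid G Z w x y N k a μ ν b ρ σ c l) (hbc : G.dir b c) (hac : G.skeleton.Adj a c) :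
    ¬ H.TriplexPattern a b c := by
  obtain ⟨rfl, rfl⟩ := M.edge'.unique (show G.Edge tail b c head from hbc)
  have hcost := M.cost
  have hwb := S.pos b
  by_cases hac1 : G.dir a c
  · rcases S.dir_or_exists_exit M.left M.edge (.step M.right M.edge'.symm M.passes.symm)
      (by omega) hac1 M.edge'.adj with h | ⟨k', hk', u, hu, huc⟩
    · exact MixedGraph.not_triplexPattern_of_dir h
    · have := S.min _ _ _ _ _ head hu huc M.right
      omega
  have hca : G.Into c a := by
    rcases hac with h | h | h | h
    · exact Or.inr (Or.inl h.symm)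
    · exact absurd h hac1
    · exact Or.inl h
    · exact Or.inr (Or.inr h.symm)
  have hba : G.dir b a := dir_of_dir_into S.mampG hbc hca M.edge.adj.symm
  obtain ⟨rfl, rfl⟩ := M.edge.unique (show G.Edge head a b tail from hba)
  rcases hca with h | h | h
  · rcases S.symm.dir_or_exists_exit M.right M.edge'.symm (.step M.left M.edge M.passes)
      (by omega) h M.edge.adj.symm with h | ⟨k', hk', u, hu, hua⟩
    · exact not_triplexPattern_of_dir_left h
    · have := S.symm.min _ _ _ _ _ head hu hua M.left
      omega
  · rcases M.left.exists_line_of_head S.left with h1 | ⟨ha, k', p, hp, hpa, hk⟩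
    · rcases M.right.exists_line_of_head S.right with h2 | ⟨hc, l', q, hq, hqc, hl⟩
      · have := S.min _ _ _ _ _ line h1 h.symm h2
        omega
      · exact fun ht => M.symm.not_triplexPattern_of_fork S.symm hbc hba h hc hq hqc hl ht.symm
    · exact M.not_triplexPattern_of_fork S hba hbc h.symm ha hp hpa hk
  · have := S.min _ _ _ _ _ head M.left h.symm M.right
    omega

/-- A non-triplex of a lightest open route in `G` is a non-triplex in `H`. -/
lemma Mid.not_triplexPattern (S : Setting G H Z w x y N)
    (M : Mid G Z w x y N k a μ ν b ρ σ c l) (ht : ¬ ν.Triplex ρ) : ¬ H.TriplexPattern a b c := by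
  have htG : ¬ G.TriplexPattern a b c := fun h => ht ((triplexPattern_iff M.edge M.edge').1 h)
  have hcost := M.cost
  by_cases hac : a = c
  -- In the backtrack `p - a ← b → a - q`, both `p, a, b` and `b, a, q` are triplexes of `H` while
  -- the unshielded `p, a, q` is not, which forces `b → a` in `H`.
  · subst hac
    obtain ⟨hba, ha, ⟨k', p, hp, hpa, hk⟩, l', q, hq, hqa, hl⟩ := M.exists_of_eq S
    have h1 := M.triplexPattern_prev S hba ha hp hpa hk
    have h2 := M.symm.triplexPattern_prev S.symm hba ha hq hqa hl
    have hpq : p ≠ q := by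
      rintro rfl
      have := S.glue_line_line hp hq
      have := S.pos a
      have := S.pos b
      omega
    have hpq' : ¬ G.skeleton.Adj p q := by
      intro h
      have := S.min _ _ _ _ _ line hp (undir_of_undir_undir S.mampG hpa hqa.symm h) hq
      have := S.pos a
      omega
    refine not_triplexPattern_of_dir_left (dir_of_triplexPattern_of_triplexPattern S.mampH h1
      h2.symm (fun h => ?_) (fun h => hpq' ((S.adj _ _).1 h)) hpq)
    exact not_triplexPattern_of_undir hpa hqa.symm
      ((S.triplex _ _ _ hpq hpq' (Or.inl hpa) (Or.inl hqa.symm)).1 h)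
  by_cases hadj : G.skeleton.Adj a c
  swap
  · exact fun h => htG ((S.triplex _ _ _ hac hadj M.edge.adj M.edge'.adj).1 h)
  rcases not_triplexPattern_cases M.edge.adj M.edge'.adj htG with h | h | ⟨h, h'⟩
  · exact fun h1 => M.symm.not_triplexPattern_of_dir S.symm h hadj.symm h1.symm
  · exact M.not_triplexPattern_of_dir S h hadj
  · obtain ⟨rfl, rfl⟩ := M.edge.unique (show G.Edge line a b line from h)
    obtain ⟨rfl, rfl⟩ := M.edge'.unique (show G.Edge line b c line from h')
    have := S.min _ _ _ _ _ line M.left (undir_of_undir_undir S.mampG h h' hadj) M.right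
    have := S.pos b
    omega

end MixedGraph

/-! ### Shortest chains to `Z`, and the transfer of open routes. -/

namespace MixedGraph

variable {V : Type*} {G H : MixedGraph V}

open Mark

/-- There is a chain of `n` directed edges from the node to `Z`. -/
def ChainTo (G : MixedGraph V) (Z : Set V) : ℕ → V → Prop
  | 0, a => a ∈ Z
  | n + 1, a => ∃ b, G.dir a b ∧ ChainTo G Z n b

/-- The shortest chain of directed edges from the node to `Z` has `n` edges. -/
def DistTo (G : MixedGraph V) (Z : Set V) (n : ℕ) (a : V) : Prop :=
  G.ChainTo Z n a ∧ ∀ m < n, ¬ G.ChainTo Z m a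

variable {Z : Set V} {a b c d : V} {n : ℕ}

lemma exists_chainTo (h : a ∈ G.An Z) : ∃ n, G.ChainTo Z n a := by
  obtain ⟨z, hz, h⟩ := h
  induction h using Relation.ReflTransGen.head_induction_on with
  | refl => exact ⟨0, hz⟩
  | head h _ ih =>
    obtain ⟨n, hn⟩ := ih
    exact ⟨n + 1, _, h, hn⟩

lemma exists_distTo (h : a ∈ G.An Z) : ∃ n, G.DistTo Z n a := by
  classical
  exact ⟨Nat.find (exists_chainTo h), Nat.find_spec (exists_chainTo h),
    fun m hm => Nat.find_min (exists_chainTo h) hm⟩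

lemma ChainTo.mem_An (h : G.ChainTo Z n a) : a ∈ G.An Z := by
  induction n generalizing a with
  | zero => exact subset_An h
  | succ n ih =>
    obtain ⟨b, hab, hb⟩ := h
    exact mem_An_of_dir hab (ih hb)

lemma DistTo.notMem (h : G.DistTo Z (n + 1) a) : a ∉ Z := h.2 0 (Nat.succ_pos n)

lemma DistTo.exists_dir (h : G.DistTo Z (n + 1) a) : ∃ b, G.dir a b ∧ G.DistTo Z n b := by
  obtain ⟨⟨b, hab, hb⟩, h⟩ := h
  exact ⟨b, hab, hb, fun m hm hm' => h (m + 1) (by omega) ⟨b, hab, hm'⟩⟩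

/-- Along a shortest chain to `Z` there are no shielded nodes. -/
lemma not_adj_of_distTo (hG : G.IsMAMP) {m : ℕ} (hb : G.DistTo Z (m + 2) b) (hbd : G.dir b d)
    (hde : G.dir d c) (hc : G.DistTo Z m c) : ¬ G.skeleton.Adj b c ∧ b ≠ c := by
  refine ⟨fun h => hb.2 (m + 1) (by omega) ⟨c, ?_, hc.1⟩, ?_⟩
  · exact dir_of_dir_into hG hbd (Or.inl hde) h
  · rintro rfl
    exact G.dir_asymm _ _ hbd hde

variable {w : V → ℕ} {x y : V} {N k l : ℕ} {μ ν ρ σ : Mark}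

lemma Setting.not_triplexPattern_chain (S : Setting G H Z w x y N) {m : ℕ}
    (hb : G.DistTo Z (m + 2) b) (hbd : G.dir b d)
    (hde : G.dir d c) (hc : G.DistTo Z m c) : ¬ H.TriplexPattern b d c := by
  obtain ⟨h1, h2⟩ := not_adj_of_distTo S.mampG hb hbd hde hc
  exact fun h => not_triplexPattern_of_dir hde ((S.triplex _ _ _ h2 h1 (Or.inr (Or.inl hbd))
    (Or.inr (Or.inl hde))).1 h)

/-- Consecutive edges of a shortest chain are unshielded non-triplexes in both graphs, so the
direction of the first edge propagates along the chain in `H`. -/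
lemma Setting.mem_An (S : Setting G H Z w x y N) (hd : G.DistTo Z n d)
    (hb : G.DistTo Z (n + 1) b) (hbd : G.dir b d) (hbd' : H.dir b d) : d ∈ H.An Z := by
  induction n generalizing b d with
  | zero => exact subset_An hd.1
  | succ n ih =>
    obtain ⟨e, hde, he⟩ := hd.exists_dir
    have h := dir_of_dir_of_not_triplexPattern hbd' ((S.adj _ _).2 (Or.inr (Or.inl hde)))
      (S.not_triplexPattern_chain hb hbd hde he)
    exact mem_An_of_dir h (ih he hd hde h)

/-- When the chain continues with `d - e` in `H`, the nodes `a` and `e` are adjacent: otherwise `a →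
d - e` would be a triplex of `H` but not of `G`. -/
lemma Setting.mem_An_or_exists (S : Setting G H Z w x y N) (hd : G.DistTo Z n d)
    (hb : G.DistTo Z (n + 1) b) (hbd : G.dir b d) (hbd' : H.undir.Adj b d) (had : G.dir a d)
    (had' : H.dir a d) : d ∈ H.An Z ∨ ∃ m e, n = m + 1 ∧ G.dir d e ∧ G.DistTo Z m e ∧
      H.undir.Adj d e ∧ G.dir a e ∧ H.dir a e := by
  cases n with
  | zero => exact Or.inl (subset_An hd.1)
  | succ n =>
    obtain ⟨e, hde, he⟩ := hd.exists_dir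
    have hHde : H.skeleton.Adj d e := (S.adj _ _).2 (Or.inr (Or.inl hde))
    rcases not_triplexPattern_cases (Or.inl hbd') hHde
      (S.not_triplexPattern_chain hb hbd hde he) with h | h | ⟨-, h⟩
    · exact absurd hbd'.symm (H.not_undir_of_dir _ _ h)
    · exact Or.inl (mem_An_of_dir h (S.mem_An he hd hde h))
    · by_cases hae : G.skeleton.Adj a e
      · exact Or.inr ⟨n, e, rfl, hde, he, h, dir_of_dir_into S.mampG had (Or.inl hde) hae,
          dir_of_dir_into S.mampH had' (Or.inr (Or.inl h)) ((S.adj _ _).2 hae)⟩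
      · have hae' : a ≠ e := by
          rintro rfl
          exact G.dir_asymm _ _ had hde
        exact absurd ((S.triplex _ _ _ hae' hae (Or.inr (Or.inl had))
          (Or.inr (Or.inl hde))).1 (Or.inr (Or.inl ⟨Or.inl had', h⟩)))
          (not_triplexPattern_of_dir hde)

/-- The route jumps from `a` to the first chain node that is an ancestor of `Z` in `H` and returns
along undirected edges, through nodes outside `Z`. -/
lemma Setting.exists_exit_line (S : Setting G H Z w x y N) (hd : G.DistTo Z n d)
    (hb : G.DistTo Z (n + 1) b) (hbd : G.dir b d) (hbd' : H.undir.Adj b d) (had : G.dir a d)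
    (had' : H.dir a d) (h : ∃ k, Exit H Z ∅ w x k a tail) :
    ∃ k, Exit H Z ∅ w x k d line := by
  induction n generalizing b d with
  | zero =>
    obtain ⟨k, h⟩ := h
    exact ⟨_, h.step_dir_line had' (subset_An hd.1)⟩
  | succ n ih =>
    rcases S.mem_An_or_exists hd hb hbd hbd' had had' with h1 | ⟨m, e, hm, hde, he, hde', hae, hae'⟩
    · obtain ⟨k, h⟩ := h
      exact ⟨_, h.step_dir_line had' h1⟩
    · obtain rfl : n = m := by omega
      obtain ⟨k, h2⟩ := ih he hd hde hde' hae hae'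
      exact ⟨_, h2.step_undir_line hde'.symm hd.notMem⟩

/-- The mirror image: the route follows the undirected edges of the chain from `b` to the turning
point and leaves it against an arrow from `a`. -/
lemma Setting.exists_exit_head (S : Setting G H Z w x y N) (hd : G.DistTo Z n d)
    (hb : G.DistTo Z (n + 1) b) (hbd : G.dir b d) (hbd' : H.undir.Adj b d) (had : G.dir a d)
    (had' : H.dir a d) (h : ∃ k, Exit H Z ∅ w x k b line) :
    ∃ k e, Exit H Z ∅ w x k e head ∧ H.dir a e := by
  induction n generalizing b d with
  | zero =>
    obtain ⟨k, h⟩ := h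
    exact ⟨_, d, h.step_undir_head hbd' (subset_An hd.1), had'⟩
  | succ n ih =>
    obtain ⟨k, h⟩ := h
    rcases S.mem_An_or_exists hd hb hbd hbd' had had' with h1 | ⟨m, e, hm, hde, he, hde', hae, hae'⟩
    · exact ⟨_, d, h.step_undir_head hbd' h1, had'⟩
    · obtain rfl : n = m := by omega
      exact ih he hd hde hde' hae hae'
        ⟨_, h.step_undir_line hbd' hd.notMem⟩

/-- There is an open route from `x` to `a` whose last edge has the given mark at `a`. -/
def Entry (G : MixedGraph V) (Z E : Set V) (w : V → ℕ) (x a : V) (μ : Mark) : Prop :=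
  ∃ k b ν, Exit G Z E w x k b ν ∧ G.Edge ν b a μ

lemma Setting.dir_of_distTo (S : Setting G H Z w x y N) (M : Mid G Z w x y N k a μ ν b ρ σ c l)
    (ht : G.TriplexPattern a b c) (htH : H.TriplexPattern a b c) (hbd : G.dir b d)
    (hd : d ∈ G.An Z) : H.dir b d ∨
    (H.dir a b ∧ G.dir a d ∧ H.dir a d ∧ H.undir.Adj b c ∧ H.undir.Adj b d) ∨
    (H.dir c b ∧ G.dir c d ∧ H.dir c d ∧ H.undir.Adj b a ∧ H.undir.Adj b d) := by
  have hHbd : H.skeleton.Adj b d := (S.adj _ _).2 (Or.inr (Or.inl hbd))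
  have key : ∀ u, G.Into u b → ¬ G.skeleton.Adj u d → u ≠ d ∧ ¬ H.TriplexPattern u b d := by
    intro u hu hud
    have hud' : u ≠ d := by
      rintro rfl
      exact hu.not_dir hbd
    exact ⟨hud', fun h => not_triplexPattern_of_dir hbd ((S.triplex _ _ _ hud' hud hu.adj
      (Or.inr (Or.inl hbd))).1 h)⟩
  by_cases had : G.skeleton.Adj a d
  · have hadd := dir_of_into_dir S.mampG ht.into hbd had
    by_cases hcd : G.skeleton.Adj c d
    · have hcdd := dir_of_into_dir S.mampG ht.into_right hbd hcd
      rcases S.dir_or_exists_exit M.left M.edge (.step M.right M.edge'.symm M.passes.symm)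
        (by have := M.cost; omega) hadd (Or.inr (Or.inl hbd)) with h | ⟨k', hk', u, hu, hud⟩
      · exact Or.inl h
      rcases S.symm.dir_or_exists_exit M.right M.edge'.symm (.step M.left M.edge M.passes)
        (by have := M.cost; omega) hcdd (Or.inr (Or.inl hbd)) with h | ⟨l', hl', v, hv, hvd⟩
      · exact Or.inl h
      -- The route through `u → d ← v` avoids `b`, and it is lighter because `w d < w b`.
      have h1 := S.min _ _ _ _ head tail (hu.step_dir_head hud hd) hvd hv
      have h2 := S.lt _ _ hbd
      have h3 := M.cost
      omega
    · obtain ⟨h1, h2⟩ := key c ht.into_right hcd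
      rcases dir_or_undir_of_triplexPattern S.mampH htH h2 (fun h => hcd ((S.adj _ _).1 h)) h1
        ((S.adj _ _).2 had) hHbd with h | ⟨h3, h4, h5, h6⟩
      · exact Or.inl h
      · exact Or.inr (Or.inl ⟨h3, hadd, h4, h5, h6⟩)
  · obtain ⟨h1, h2⟩ := key a ht.into had
    by_cases hcd : G.skeleton.Adj c d
    · have hcdd := dir_of_into_dir S.mampG ht.into_right hbd hcd
      rcases dir_or_undir_of_triplexPattern S.mampH htH.symm h2 (fun h => had ((S.adj _ _).1 h)) h1
        ((S.adj _ _).2 hcd) hHbd with h | ⟨h3, h4, h5, h6⟩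
      · exact Or.inl h
      · exact Or.inr (Or.inr ⟨h3, hcdd, h4, h5, h6⟩)
    · exact Or.inl (dir_of_not_triplexPattern_of_not_triplexPattern htH h2
        (key c ht.into_right hcd).2 hHbd)

/-- The second half of the invariant supplies the start at `a` of a detour through the chain back to
`b`. The detour on the other side reaches `c` from the chain without leaving `b` for `c`; then `c →
b` in `H`, and the second half is vacuous. -/
lemma Setting.transfer_step (S : Setting G H Z w x y N) (M : Mid G Z w x y N k a μ ν b ρ σ c l)
    {μ' ν' ρ' σ' : Mark} (e : H.Edge μ' a b ν') (e' : H.Edge ρ' b c σ')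
    (h : Entry H Z ∅ w x b ν') (h' : H.dir a b → ∃ k, Exit H Z ∅ w x k a tail) :
    Entry H Z ∅ w x c σ' ∧ (H.dir b c → ∃ k, Exit H Z ∅ w x k b tail) := by
  suffices hs : (∃ k, Exit H Z ∅ w x k b ρ') ∨ (H.dir c b ∧ Entry H Z ∅ w x c σ') by
    rcases hs with ⟨j, hs⟩ | ⟨h1, h2⟩
    · refine ⟨⟨_, _, _, hs, e'⟩, fun hbc => ?_⟩
      obtain ⟨rfl, -⟩ := e'.unique (show H.Edge tail b c head from hbc)
      exact ⟨_, hs⟩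
    · exact ⟨h2, fun h3 => absurd h1 (H.dir_asymm _ _ h3)⟩
  obtain ⟨j, u, κ, hu, eu⟩ := h
  by_cases ht : ν.Triplex ρ
  · have htG := (triplexPattern_iff M.edge M.edge').2 ht
    have htH := M.triplexPattern S ht
    by_cases hb : b ∈ H.An Z
    · exact Or.inl ⟨_, hu.step eu (passes_empty_iff.2 ⟨fun _ => hb,
        fun h => absurd ((triplexPattern_iff e e').1 htH) h⟩)⟩
    obtain ⟨n, hn⟩ := exists_distTo (M.passes.1 ht)
    cases n with
    | zero => exact absurd (subset_An hn.1) hb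
    | succ n =>
      obtain ⟨d, hbd, hd⟩ := hn.exists_dir
      rcases S.dir_of_distTo M htG htH hbd hd.1.mem_An with
        h1 | ⟨h1, h2, h3, h4, h5⟩ | ⟨h1, h2, h3, h4, h5⟩
      · exact absurd (mem_An_of_dir h1 (S.mem_An hd hn hbd h1)) hb
      · obtain ⟨j', hj⟩ := S.exists_exit_line hd hn hbd h5 h2 h3 (h' h1)
        obtain ⟨rfl, -⟩ := e'.unique (show H.Edge line b c line from h4)
        exact Or.inl ⟨_, hj.step_undir_line h5.symm hn.notMem⟩
      · obtain ⟨-, rfl⟩ := e.unique (show H.Edge line a b line from h4.symm)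
        obtain ⟨-, rfl⟩ := e'.unique (show H.Edge head b c tail from h1)
        obtain ⟨j', v, hv, hcv⟩ := S.exists_exit_head hd hn hbd h5 h2 h3
          ⟨_, hu.step eu (passes_empty_iff.2 ⟨fun h => h.elim, fun _ => hn.notMem⟩)⟩
        exact Or.inr ⟨h1, _, _, _, hv, hcv⟩
  · have hb := (passes_empty_iff.1 M.passes).2 ht
    have htH := M.not_triplexPattern S ht
    rw [triplexPattern_iff e e'] at htH
    exact Or.inl ⟨_, hu.step eu (passes_empty_iff.2 ⟨fun h => absurd h htH, fun _ => hb⟩)⟩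

lemma Setting.transfer (S : Setting G H Z w x y N) (hl : Exit G Z ∅ w x k a μ)
    (e : G.Edge μ a b ν) (hr : Exit G Z ∅ w y l b ν) (hN : k + l = N) {μ' ν' : Mark}
    (e' : H.Edge μ' a b ν') :
    Entry H Z ∅ w x b ν' ∧ (H.dir a b → ∃ k, Exit H Z ∅ w x k a tail) := by
  induction hl generalizing b ν l μ' ν' with
  | start => exact ⟨⟨_, _, _, .start _, e'⟩, fun _ => ⟨_, .start _⟩⟩
  | @step k p a α β ρ h e1 pp ih =>
    obtain ⟨α', β', e1'⟩ := exists_edge ((S.adj _ _).2 e1.adj)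
    obtain ⟨h1, h2⟩ := ih e1 (.step hr e.symm pp.symm) (by omega) e1'
    exact S.transfer_step ⟨h, e1, pp, e, hr, hN⟩ e1' e' h1 h2

/-- Between triplex equivalent graphs, the existence of open routes carries over. -/
lemma exists_entry_of_triplexEquivalent [Finite V] (hG : G.IsMAMP) (hH : H.IsMAMP)
    (hadj : ∀ a b, H.skeleton.Adj a b ↔ G.skeleton.Adj a b)
    (ht : ∀ a b c, a ≠ c → ¬ G.skeleton.Adj a c → G.skeleton.Adj a b → G.skeleton.Adj b c →
      (H.TriplexPattern a b c ↔ G.TriplexPattern a b c))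
    (hxy : x ≠ y) (hx : x ∉ Z) (hy : y ∉ Z)
    (hE : ∃ w μ, Entry G Z ∅ w x y μ) : ∃ w μ, Entry H Z ∅ w x y μ := by
  classical
  -- A node is its own descendant, so weights are positive; along `a → b` at least `a` is lost, by
  -- (C1).
  let w : V → ℕ := fun a => {b | G.StrictlyDescendingRoute a b}.ncard
  have hpos : ∀ v, 0 < w v := fun v =>
    (Set.ncard_pos (Set.toFinite _)).2 ⟨v, Relation.ReflTransGen.refl⟩
  have hlt : ∀ a b, G.dir a b → w b < w a := by
    intro a b hab
    refine Set.ncard_lt_ncard ⟨fun c hc => .head hab hc, fun h => ?_⟩ (Set.toFinite _)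
    have h1 : G.StrictlyDescendingRoute b a := h (Relation.ReflTransGen.refl (a := a))
    exact hG.no_semidirected_cycle a b hab h1.descendingRoute
  have hex : ∃ n, ∃ k l a b μ ν, Exit G Z ∅ w x k a μ ∧ G.Edge μ a b ν ∧
      Exit G Z ∅ w y l b ν ∧ k + l = n := by
    obtain ⟨w', μ, k, b, ν, h, e⟩ := hE
    -- The same route, weighed by the new `w`.
    have key : ∃ k, Exit G Z ∅ w x k b ν := by
      clear e
      induction h with
      | start => exact ⟨_, .start _⟩
      | step _ e p ih =>
        obtain ⟨k, ih⟩ := ih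
        exact ⟨_, ih.step e p⟩
    obtain ⟨k', h'⟩ := key
    exact ⟨_, _, _, _, _, _, _, h', e, .start _, rfl⟩
  obtain ⟨k, l, a, b, μ, ν, h1, h2, h3, h4⟩ := Nat.find_spec hex
  have S : Setting G H Z w x y (Nat.find hex) :=
    ⟨hG, hH, hadj, ht, hpos, hlt, hxy, hx, hy, fun k l a b μ ν h1 h2 h3 =>
      Nat.find_min' hex ⟨k, l, a, b, μ, ν, h1, h2, h3, rfl⟩⟩
  generalize Nat.find hex = N at *
  clear hex hE
  refine ⟨w, ?_⟩
  -- The half from `y` is moved edge by edge to the half from `x`, since `Setting.transfer` follows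
  -- the latter.
  have main : ∀ {l b ν}, Exit G Z ∅ w y l b ν → ∀ {k a μ}, Exit G Z ∅ w x k a μ →
      G.Edge μ a b ν → k + l = N → ∃ μ, Entry H Z ∅ w x y μ := by
    intro l b ν h
    induction h with
    | start =>
      intro k a μ h e hN
      obtain ⟨α, β, e'⟩ := exists_edge ((hadj _ _).2 e.adj)
      exact ⟨_, (S.transfer h e (.start _) hN e').1⟩
    | step h e p ih =>
      intro k a μ h' e' hN
      exact ih (h'.step e' p.symm) e.symm (by omega)
  exact main h3 h1 h2 h4

end MixedGraph

/-! ### Open routes as lists, and removal of the exemption. -/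

namespace MixedGraph

variable {V : Type*} {G : MixedGraph V} {Z : Set V} {a b c x y : V}

open Mark

/-- The nodes of `Z` that do not block an undirected path. -/
def exempt (G : MixedGraph V) (Z : Set V) : Set V :=
  {b | (G.spouses {b}).Nonempty ∨ (G.parents {b} \ Z).Nonempty}

lemma mem_exempt_of_bidir (h : G.bidir.Adj a b) : b ∈ G.exempt Z :=
  Or.inl ⟨a, h.ne, b, rfl, h⟩

lemma mem_exempt_of_dir (h : G.dir a b) (ha : a ∉ Z) : b ∈ G.exempt Z :=
  Or.inr ⟨a, ⟨by rintro rfl; exact G.dir_irrefl _ h, b, rfl, h⟩, ha⟩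

lemma exists_of_mem_exempt (h : b ∈ G.exempt Z) :
    (∃ a, G.bidir.Adj b a) ∨ ∃ a, G.dir a b ∧ a ∉ Z := by
  rcases h with ⟨a, -, b', rfl, h⟩ | ⟨a, ⟨-, b', rfl, h⟩, ha⟩
  · exact Or.inl ⟨a, h.symm⟩
  · exact Or.inr ⟨a, h, ha⟩

/-- The node `b` between `a` and `c` does not block a path. -/
def Unblocked (G : MixedGraph V) (Z : Set V) (a b c : V) : Prop :=
  (G.TriplexPattern a b c → b ∈ G.An Z) ∧ (¬ G.TriplexPattern a b c →
    b ∉ Z ∨ (G.undir.Adj a b ∧ G.undir.Adj b c ∧ b ∈ G.exempt Z))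

lemma Unblocked.symm (h : G.Unblocked Z a b c) : G.Unblocked Z c b a :=
  ⟨fun ht => h.1 ht.symm, fun ht => (h.2 fun h => ht h.symm).imp id
    fun ⟨h1, h2, h3⟩ => ⟨h2.symm, h1.symm, h3⟩⟩

lemma Unblocked.passes {μ ν ρ σ : Mark} (h : G.Unblocked Z a b c) (e : G.Edge μ a b ν)
    (e' : G.Edge ρ b c σ) : G.Passes Z (G.exempt Z) ν ρ b := by
  rw [Unblocked, triplexPattern_iff e e'] at h
  refine ⟨h.1, fun ht => (h.2 ht).imp id fun ⟨h1, h2, h3⟩ => ?_⟩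
  exact ⟨(e.unique (show G.Edge line a b line from h1)).2,
    (e'.unique (show G.Edge line b c line from h2)).1, h3⟩

lemma Passes.unblocked {μ ν ρ σ : Mark} (h : G.Passes Z ∅ ν ρ b) (e : G.Edge μ a b ν)
    (e' : G.Edge ρ b c σ) : G.Unblocked Z a b c := by
  rw [Unblocked, triplexPattern_iff e e']
  rw [passes_empty_iff] at h
  exact ⟨h.1, fun ht => Or.inl (h.2 ht)⟩

/-- The nodes of an open route. -/
def OpenList (G : MixedGraph V) (Z : Set V) (l : List V) : Prop :=
  l.IsChain G.skeleton.Adj ∧ ∀ a b c, [a, b, c] <:+: l → G.Unblocked Z a b c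

lemma OpenList.infix {l l' : List V} (h : G.OpenList Z l) (h' : l' <:+: l) : G.OpenList Z l' :=
  ⟨h.1.infix h', fun _ _ _ hi => h.2 _ _ _ (hi.trans h')⟩

lemma OpenList.reverse {l : List V} (h : G.OpenList Z l) : G.OpenList Z l.reverse := by
  refine ⟨?_, fun a b c hi => ?_⟩
  · rw [List.isChain_reverse]
    exact h.1.imp fun _ _ h => h.symm
  · refine (h.2 c b a ?_).symm
    rw [← List.reverse_infix]
    simpa using hi

lemma openList_cons_cons_cons {t : List V} :
    G.OpenList Z (a :: b :: c :: t) ↔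
      G.skeleton.Adj a b ∧ G.Unblocked Z a b c ∧ G.OpenList Z (b :: c :: t) := by
  constructor
  · intro h
    exact ⟨(List.isChain_cons_cons.1 h.1).1, h.2 _ _ _ ⟨[], t, by simp⟩,
      h.infix (List.infix_cons_iff.2 (Or.inr (List.infix_refl _)))⟩
  · rintro ⟨h1, h2, h3⟩
    refine ⟨List.isChain_cons_cons.2 ⟨h1, h3.1⟩, fun a' b' c' hi => ?_⟩
    rcases List.infix_cons_iff.1 hi with hi | hi
    · simp only [List.cons_prefix_cons] at hi
      obtain ⟨rfl, rfl, rfl, -⟩ := hi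
      exact h2
    · exact h3.2 _ _ _ hi

lemma openList_pair (h : G.skeleton.Adj a b) : G.OpenList Z [a, b] :=
  ⟨by simpa using h, fun _ _ _ hi => by simpa using hi.length_le⟩

lemma openList_triple (h : G.skeleton.Adj a b) (h' : G.skeleton.Adj b c)
    (hu : G.Unblocked Z a b c) : G.OpenList Z [a, b, c] :=
  openList_cons_cons_cons.2 ⟨h, hu, openList_pair h'⟩

/-- There is an open route between two nodes. -/
def OpenConn (G : MixedGraph V) (Z : Set V) (x y : V) : Prop :=
  ∃ l, G.OpenList Z l ∧ l.head? = some x ∧ l.getLast? = some y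

lemma OpenConn.symm (h : G.OpenConn Z x y) : G.OpenConn Z y x := by
  obtain ⟨l, h, hx, hy⟩ := h
  exact ⟨l.reverse, h.reverse, by simpa using hy, by simpa using hx⟩

section ToEntry

lemma OpenList.exists_entry {w : V → ℕ} {t : List V} {k : ℕ} {μ ν : Mark}
    (h : G.OpenList Z (a :: b :: t)) (hl : (a :: b :: t).getLast? = some y)
    (ha : Exit G Z (G.exempt Z) w x k a μ) (e : G.Edge μ a b ν) :
    ∃ μ, Entry G Z (G.exempt Z) w x y μ := by
  induction t generalizing a b k μ ν with
  | nil =>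
    obtain rfl : b = y := by simpa using hl
    exact ⟨_, _, _, _, ha, e⟩
  | cons c t ih =>
    obtain ⟨-, h2, h3⟩ := openList_cons_cons_cons.1 h
    obtain ⟨ρ, σ, e'⟩ := exists_edge (List.isChain_cons_cons.1 h3.1).1
    exact ih h3 (by simpa using hl) (ha.step e (h2.passes e e')) e'

lemma OpenConn.exists_entry (h : G.OpenConn Z x y) (hxy : x ≠ y) (w : V → ℕ) :
    ∃ μ, Entry G Z (G.exempt Z) w x y μ := by
  obtain ⟨l, h, hx, hy⟩ := h
  match l, h, hx, hy with
  | [a], h, hx, hy => simp_all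
  | a :: b :: t, h, hx, hy =>
    obtain rfl : a = x := by simpa using hx
    obtain ⟨μ, ν, e⟩ := exists_edge (List.isChain_cons_cons.1 h.1).1
    exact h.exists_entry hy (.start _) e

variable {w : V → ℕ} {μ : Mark}

lemma Exit.of_undir_of_passes {k : ℕ} {ν : Mark} (h : Exit G Z ∅ w x k a line)
    (hp : G.Passes Z (G.exempt Z) line ν a) : Exit G Z ∅ w x k a ν := by
  cases ν
  · exact h.to_tail (by simpa [Mark.Triplex] using hp.2)
  · exact h
  · exact h.head_of_line (hp.1 trivial)

/-- Exempt nodes can be circumvented: if there is a spouse then a shortcut may be taken, and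
otherwise a detour via a parent. -/
lemma Exit.exists_exit (hG : G.IsMAMP) {k : ℕ} (h : Exit G Z (G.exempt Z) w x k b μ) :
    (∃ k, Exit G Z ∅ w x k b μ) ∨ (μ = line ∧ ∃ k a c, Exit G Z ∅ w x k a line ∧
      G.undir.Adj a b ∧ G.bidir.Adj b c) := by
  have key : ∀ {a b : V} {k : ℕ} {μ ν ρ : Mark}, Exit G Z ∅ w x k a μ → G.Edge μ a b ν →
      G.Passes Z (G.exempt Z) ν ρ b → (∃ k, Exit G Z ∅ w x k b ρ) ∨ (ρ = line ∧ ∃ k a c,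
        Exit G Z ∅ w x k a line ∧ G.undir.Adj a b ∧ G.bidir.Adj b c) := by
    intro a b k μ ν ρ h e p
    by_cases hp : G.Passes Z ∅ ν ρ b
    · exact Or.inl ⟨_, h.step e hp⟩
    rw [passes_empty_iff] at hp
    have : ¬ ν.Triplex ρ ∧ b ∈ Z := by
      by_contra hn
      exact hp ⟨p.1, fun h1 h2 => hn ⟨h1, h2⟩⟩
    obtain ⟨h1, h2⟩ := this
    rcases p.2 h1 with h3 | ⟨rfl, rfl, h3⟩
    · exact absurd h2 h3
    cases μ <;> try exact e.elim
    rcases exists_of_mem_exempt h3 with ⟨c, hc⟩ | ⟨d, hd, hdZ⟩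
    -- The shortcut of (C3) needs the next node, so it is postponed by one step.
    · exact Or.inr ⟨rfl, _, _, c, h, e, hc⟩
    · have h4 := h.step_undir_head e (subset_An h2)
      have h5 : Exit G Z ∅ w x _ d tail := h4.step (show G.Edge head b d tail from hd)
        (passes_empty_iff.2 ⟨fun h => h.elim, fun _ => hdZ⟩)
      exact Or.inl ⟨_, h5.step_dir_line hd (subset_An h2)⟩
  induction h with
  | start => exact Or.inl ⟨_, .start _⟩
  | @step k a b μ ν ρ h e p ih =>
    rcases ih with ⟨k, h⟩ | ⟨rfl, k, a', c, h, ha, hc⟩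
    · exact key h e p
    · cases ν <;> try exact e.elim
      by_cases hab : a' = b
      · subst hab
        exact Or.inl ⟨_, h.of_undir_of_passes p⟩
      · exact key h (show G.Edge line a' b line from undir_of_bidir hG hab ha e hc) p

lemma Entry.exists_entry (hG : G.IsMAMP) (h : Entry G Z (G.exempt Z) w x y μ) (hxy : x ≠ y) :
    ∃ μ, Entry G Z ∅ w x y μ := by
  obtain ⟨k, b, ν, h, e⟩ := h
  rcases h.exists_exit hG with ⟨k, h⟩ | ⟨rfl, k, a, c, h, ha, hc⟩
  · exact ⟨_, _, _, _, h, e⟩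
  · cases μ <;> try exact e.elim
    by_cases hay : a = y
    · subst hay
      cases h with
      | start => exact absurd rfl hxy
      | step h e _ => exact ⟨_, _, _, _, h, e⟩
    · exact ⟨line, _, _, line, h, undir_of_bidir hG hay ha e hc⟩

lemma Exit.exists_openList {k : ℕ} (h : Exit G Z ∅ w x k a μ) :
    ∃ t, G.OpenList Z (a :: t) ∧ (a :: t).getLast? = some x ∧
      ∀ p ∈ t.head?, ∃ α β, G.Edge α p a β ∧ G.Passes Z ∅ β μ a := by
  induction h with
  | start =>
    exact ⟨[], ⟨by simp, fun _ _ _ hi => by simpa using hi.length_le⟩, by simp, by simp⟩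
  | @step k a b μ ν ρ h e p ih =>
    obtain ⟨t, h1, h2, h3⟩ := ih
    refine ⟨a :: t, ?_, by simpa using h2, by simpa using ⟨_, _, e, p⟩⟩
    cases t with
    | nil => exact openList_pair e.adj.symm
    | cons c t =>
      obtain ⟨α, β, e', p'⟩ := h3 c (by simp)
      exact openList_cons_cons_cons.2 ⟨e.adj.symm, (p'.unblocked e' e).symm, h1⟩

lemma Entry.openConn (h : Entry G Z ∅ w x y μ) : G.OpenConn Z x y := by
  obtain ⟨k, b, ν, h, e⟩ := h
  obtain ⟨t, h1, h2, h3⟩ := h.exists_openList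
  refine OpenConn.symm ⟨y :: b :: t, ?_, by simp, by simpa using h2⟩
  cases t with
  | nil => exact openList_pair e.adj.symm
  | cons c t =>
    obtain ⟨α, β, e', p'⟩ := h3 c (by simp)
    exact openList_cons_cons_cons.2 ⟨e.adj.symm, (p'.unblocked e' e).symm, h1⟩

end ToEntry

/-! ### Cutting open routes down to open paths. -/

section Paths

/-- A route that starts along an arrow follows arrows until its first triplex node, and that node is
an ancestor of `Z`. -/
lemma OpenList.mem_An_or_strictlyDescendingRoute {d : V} {t : List V}
    (h : G.OpenList Z (b :: d :: t)) (hbd : G.dir b d)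
    (hl : (d :: t).getLast? = some c) : b ∈ G.An Z ∨ G.StrictlyDescendingRoute d c := by
  induction t generalizing b d with
  | nil =>
    obtain rfl : d = c := by simpa using hl
    exact Or.inr .refl
  | cons e t ih =>
    obtain ⟨-, h2, h3⟩ := openList_cons_cons_cons.1 h
    by_cases ht : G.TriplexPattern b d e
    · exact Or.inl (mem_An_of_dir hbd (h2.1 ht))
    · have hde := dir_of_dir_of_not_triplexPattern hbd (List.isChain_cons_cons.1 h3.1).1 ht
      rcases ih h3 hde (by simpa using hl) with h4 | h4
      · exact Or.inl (mem_An_of_dir hbd h4)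
      · exact Or.inr (.head hde h4)

lemma OpenList.mem_An_of_cycle (hG : G.IsMAMP) {d : V} {t : List V}
    (h : G.OpenList Z (b :: d :: t)) (hl : (d :: t).getLast? = some b) (hbd : G.dir b d) :
    b ∈ G.An Z := by
  rcases h.mem_An_or_strictlyDescendingRoute hbd hl with h | h
  · exact h
  · exact absurd h.descendingRoute (hG.no_semidirected_cycle _ _ hbd)

/-- A loop can be cut out of an open route. -/
lemma OpenList.unblocked_of_loop (hG : G.IsMAMP) {m : List V}
    (h : G.OpenList Z (a :: b :: (m ++ [b, c]))) : G.Unblocked Z a b c := by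
  have hloop : G.OpenList Z (b :: (m ++ [b])) := h.infix ⟨[a], [c], by simp⟩
  obtain ⟨d, m', hm⟩ : ∃ d m', m = d :: m' := by
    cases m with
    | nil => simpa using hloop.1
    | cons d m' => exact ⟨d, m', rfl⟩
  obtain ⟨m'', d', hm'⟩ : ∃ m'' d', m = m'' ++ [d'] := by
    rcases List.eq_nil_or_concat m with rfl | ⟨m'', d', h⟩
    · simp at hm
    · exact ⟨m'', d', by simpa using h⟩
  have hab : G.skeleton.Adj a b := (List.isChain_cons_cons.1 h.1).1
  have hbc : G.skeleton.Adj b c := by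
    have := (h.infix (l' := [b, c]) ⟨a :: b :: m, [], by simp⟩).1
    simpa using this
  have hbd : G.skeleton.Adj b d := by
    have := (hloop.infix (l' := [b, d]) ⟨[], m' ++ [b], by simp [hm]⟩).1
    simpa using this
  have hbd' : G.skeleton.Adj d' b := by
    have := (hloop.infix (l' := [d', b]) ⟨b :: m'', [], by simp [hm']⟩).1
    simpa using this
  have h1 : G.Unblocked Z a b d := h.2 _ _ _ ⟨[], m' ++ [b, c], by simp [hm]⟩
  have h2 : G.Unblocked Z d' b c := h.2 _ _ _ ⟨a :: b :: m'', [], by simp [hm']⟩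
  have hdir : G.dir b d → b ∈ G.An Z := by
    subst hm
    exact fun hd => hloop.mem_An_of_cycle hG (d := d) (t := m' ++ [b])
      (List.getLast?_concat (l := d :: m')) hd
  have hdir' : G.dir b d' → b ∈ G.An Z := by
    subst hm'
    have := hloop.reverse
    simp only [List.reverse_cons, List.reverse_append, List.cons_append, List.nil_append,
      List.reverse_nil] at this
    exact fun hd => this.mem_An_of_cycle hG
      (List.getLast?_concat (l := d' :: m''.reverse)) hd
  constructor
  · intro ht
    -- If `b` is not an ancestor of `Z`, neither visit to `b` is a triplex and the loop has no arrow
    -- out of `b` at either end. With the triplex at `b` this leaves `a - b - c`, which is none.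
    by_contra hb
    rcases not_triplexPattern_cases hab hbd (fun h => hb (h1.1 h)) with h3 | h3 | ⟨h3, -⟩
    · exact ht.into.not_dir h3
    · exact hb (hdir h3)
    rcases not_triplexPattern_cases hbd' hbc (fun h => hb (h2.1 h)) with h4 | h4 | ⟨-, h4⟩
    · exact hb (hdir' h4)
    · exact ht.into_right.not_dir h4
    · exact not_triplexPattern_of_undir h3 h4 ht
  · intro ht
    by_contra hcon
    simp only [not_or, not_not] at hcon
    obtain ⟨hb, hcon⟩ := hcon
    rcases not_triplexPattern_cases hab hbc ht with h3 | h3 | ⟨h3, h4⟩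
    · rcases h1.2 (not_triplexPattern_of_dir_left h3) with h5 | ⟨h5, -⟩
      · exact h5 hb
      · exact G.not_undir_of_dir _ _ h3 h5.symm
    · rcases h2.2 (not_triplexPattern_of_dir h3) with h5 | ⟨-, h5, -⟩
      · exact h5 hb
      · exact G.not_undir_of_dir _ _ h3 h5
    · refine hcon ⟨h3, h4, ?_⟩
      by_cases h5 : G.TriplexPattern a b d
      · have h6 : G.ArrowInto d b := by
          rcases h5 with h | h | h
          · exact h.2
          · rcases h.1 with h7 | h7
            · exact absurd h3 (G.not_undir_of_dir _ _ h7)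
            · exact absurd h7 (G.not_bidir_of_undir _ _ h3)
          · exact h.2
        rcases h6 with h6 | h6
        -- As `d → b`, the node `d` is not a triplex node of the loop and the edge to `b` is not
        -- undirected, so `d` is outside `Z`: it is the parent that exempts `b`.
        · refine mem_exempt_of_dir h6 fun hd => ?_
          obtain ⟨e, m₁, he⟩ : ∃ e m₁, m' ++ [b] = e :: m₁ := by
            cases m' with
            | nil => exact ⟨b, [], rfl⟩
            | cons e m₁ => exact ⟨e, m₁ ++ [b], rfl⟩
          have h7 : G.Unblocked Z b d e := hloop.2 _ _ _ ⟨[], m₁, by simp [hm, he]⟩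
          rcases h7.2 (not_triplexPattern_of_dir_left h6) with h8 | ⟨h8, -⟩
          · exact h8 hd
          · exact G.not_undir_of_dir _ _ h6 h8.symm
        · exact mem_exempt_of_bidir h6
      · rcases h1.2 h5 with h6 | ⟨-, -, h6⟩
        · exact absurd hb h6
        · exact h6

lemma openList_append_cons {s u : List V} (h1 : G.OpenList Z (s ++ [b]))
    (h2 : G.OpenList Z (b :: u))
    (h3 : ∀ a c s' u', s = s' ++ [a] → u = c :: u' → G.Unblocked Z a b c) :
    G.OpenList Z (s ++ b :: u) := by
  induction s with
  | nil => exact h2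
  | cons a s ih =>
    match s, u with
    | [], [] => exact h1
    | [], c :: u =>
      exact openList_cons_cons_cons.2 ⟨by simpa using h1.1, h3 a c [] u rfl rfl, h2⟩
    | [d], u =>
      have h4 : G.OpenList Z (a :: d :: b :: []) := h1
      rw [openList_cons_cons_cons] at h4
      exact openList_cons_cons_cons.2 ⟨h4.1, h4.2.1, ih h4.2.2
        fun a' c s' u' hs hu => h3 a' c (a :: s') u' (by simp [hs]) hu⟩
    | d :: e :: s, u =>
      have h4 : G.OpenList Z (a :: d :: e :: (s ++ [b])) := h1
      rw [openList_cons_cons_cons] at h4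
      exact openList_cons_cons_cons.2 ⟨h4.1, h4.2.1, ih h4.2.2
        fun a' c s' u' hs hu => h3 a' c (a :: s') u' (by simp [hs]) hu⟩

lemma OpenList.cut (hG : G.IsMAMP) {s m u : List V}
    (h : G.OpenList Z (s ++ b :: (m ++ b :: u))) : G.OpenList Z (s ++ b :: u) := by
  refine openList_append_cons (h.infix ⟨[], m ++ b :: u, by simp⟩)
    (h.infix ⟨s ++ b :: m, [], by simp⟩) ?_
  rintro a c s' u' rfl rfl
  exact OpenList.unblocked_of_loop hG (m := m) (h.infix ⟨s', u', by simp⟩)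

lemma exists_append_of_duplicate {α : Type*} {b : α} {l : List α} (h : List.Duplicate b l) :
    ∃ s m u, l = s ++ b :: (m ++ b :: u) := by
  induction h with
  | cons_mem h =>
    obtain ⟨m, u, rfl⟩ := List.append_of_mem h
    exact ⟨[], m, u, rfl⟩
  | @cons_duplicate a l h ih =>
    obtain ⟨s, m, u, rfl⟩ := ih
    exact ⟨a :: s, m, u, rfl⟩

lemma OpenConn.exists_nodup (hG : G.IsMAMP) (h : G.OpenConn Z x y) :
    ∃ l : List V, l.Nodup ∧ G.OpenList Z l ∧ l.head? = some x ∧ l.getLast? = some y := by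
  obtain ⟨l, h, hx, hy⟩ := h
  induction hn : l.length using Nat.strong_induction_on generalizing l with
  | _ n ih =>
  by_cases hl : l.Nodup
  · exact ⟨l, hl, h, hx, hy⟩
  · obtain ⟨b, hb⟩ := List.exists_duplicate_iff_not_nodup.2 hl
    obtain ⟨s, m, u, rfl⟩ := exists_append_of_duplicate hb
    refine ih _ ?_ (s ++ b :: u) (h.cut hG) ?_ ?_ rfl
    · simp only [List.length_append, List.length_cons] at hn ⊢
      omega
    · cases s <;> simpa using hx
    · rw [← hy, List.getLast?_append_of_ne_nil _ (List.cons_ne_nil b u),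
        show s ++ b :: (m ++ b :: u) = (s ++ b :: m) ++ b :: u by simp,
        List.getLast?_append_of_ne_nil _ (List.cons_ne_nil b u)]

lemma exists_infix_of_mem {α : Type*} {b : α} {l : List α} (h : b ∈ l) :
    l.head? = some b ∨ l.getLast? = some b ∨ ∃ a c, [a, b, c] <:+: l := by
  obtain ⟨s, u, rfl⟩ := List.append_of_mem h
  rcases List.eq_nil_or_concat s with rfl | ⟨s', a, rfl⟩
  · simp
  · cases u with
    | nil => simp
    | cons c u => exact Or.inr (Or.inr ⟨a, c, s', u, by simp⟩)

lemma eq_of_infix_of_nodup {α : Type*} {a b c a' c' : α} {l : List α} (hl : l.Nodup)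
    (h : [a, b, c] <:+: l) (h' : [a', b, c'] <:+: l) : a = a' ∧ c = c' := by
  obtain ⟨s, t, rfl⟩ := h
  obtain ⟨s', t', h'⟩ := h'
  have h1 : (s' ++ [a']) ++ b :: (c' :: t') = (s ++ [a]) ++ b :: (c :: t) := by simpa using h'
  have h2 : ((s ++ [a]) ++ b :: (c :: t)).Nodup := by simpa using hl
  have h3 := h1 ▸ h2
  rw [List.nodup_append] at h2 h3
  rw [List.append_cons_inj_of_notMem (fun h => h3.2.2 b h b (by simp) rfl)
    (fun h => (List.nodup_cons.1 h3.2.1).1 h)] at h1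
  simp at h1
  exact ⟨h1.1.2.symm, h1.2.1.symm⟩

lemma openConn_iff (hG : G.IsMAMP) (hx : x ∉ Z) (hy : y ∉ Z) :
    (∃ p : G.skeleton.Walk x y, p.IsPath ∧ G.IsOpen p Z) ↔ G.OpenConn Z x y := by
  constructor
  · rintro ⟨p, hp, h1, h2⟩
    rw [← An_eq] at h1
    refine ⟨p.support, ⟨p.isChain_adj_support, fun a b c hi => ?_⟩, ?_, ?_⟩
    · have hb : b ∈ p.support := hi.subset (by simp)
      refine ⟨fun ht => h1 b hb ⟨a, c, hi, ht⟩, fun ht => ?_⟩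
      -- A path visits `b` once, so its status does not depend on the chosen subpath.
      have hn : ¬ G.IsTriplexNode p b := by
        rintro ⟨a', c', hi', ht'⟩
        obtain ⟨rfl, rfl⟩ := eq_of_infix_of_nodup hp.support_nodup hi hi'
        exact ht ht'
      rcases h2 b hb hn with h | ⟨⟨a', c', hi', h3, h4⟩, h5⟩
      · exact Or.inl h
      · obtain ⟨rfl, rfl⟩ := eq_of_infix_of_nodup hp.support_nodup hi hi'
        exact Or.inr ⟨h3, h4, h5⟩
    · rw [List.head?_eq_some_head p.support_ne_nil]
      simp
    · rw [List.getLast?_eq_some_getLast p.support_ne_nil]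
      simp
  · intro hc
    obtain ⟨l, hl, h, hlx, hly⟩ := hc.exists_nodup hG
    have hne : l ≠ [] := by
      rintro rfl
      simp at hlx
    rw [List.head?_eq_some_head hne, Option.some_inj] at hlx
    rw [List.getLast?_eq_some_getLast hne, Option.some_inj] at hly
    subst hlx hly
    refine ⟨.ofSupport l hne h.1, ?_, ?_, ?_⟩
    · rw [SimpleGraph.Walk.isPath_def, SimpleGraph.Walk.support_ofSupport]
      exact hl
    · rintro b - ⟨a, c, hi, ht⟩
      rw [SimpleGraph.Walk.support_ofSupport] at hi
      rw [← An_eq]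
      exact (h.2 a b c hi).1 ht
    · intro b hb hn
      simp only [IsTriplexNode, SimpleGraph.Walk.support_ofSupport] at hb hn ⊢
      rcases exists_infix_of_mem hb with h1 | h1 | ⟨a, c, hi⟩
      · rw [List.head?_eq_some_head hne, Option.some_inj] at h1
        exact Or.inl (h1 ▸ hx)
      · rw [List.getLast?_eq_some_getLast hne, Option.some_inj] at h1
        exact Or.inl (h1 ▸ hy)
      · rcases (h.2 a b c hi).2 (fun ht => hn ⟨a, c, hi, ht⟩) with h2 | ⟨h2, h3, h4⟩
        · exact Or.inl h2
        · exact Or.inr ⟨⟨a, c, hi, h2, h3⟩, h4⟩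

end Paths

end MixedGraph

/-! ### Separating non-adjacent nodes. -/

namespace MixedGraph

variable {V : Type*} {G : MixedGraph V} {Z : Set V} {a b c : V} {w : V → ℕ} {k : ℕ} {μ ν ρ : Mark}

open Mark

lemma descendingRoute_of_reachable (h : G.undir.Reachable a b) : G.DescendingRoute a b := by
  obtain ⟨p⟩ := h
  induction p with
  | nil => exact .refl
  | cons h _ ih => exact (descendingRoute_of_into (Or.inr (Or.inl h))).trans ih

/-- The second of two nodes is strictly below the first one. -/
def Below (G : MixedGraph V) (a b : V) : Prop :=
  ∃ u v, G.DescendingRoute a u ∧ G.dir u v ∧ G.DescendingRoute v b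

lemma not_below_symm (hG : G.IsMAMP) (h : G.Below a b) : ¬ G.Below b a := by
  rintro ⟨u', v', h1', h2', h3'⟩
  obtain ⟨u, v, h1, h2, h3⟩ := h
  refine hG.no_semidirected_cycle u v h2 (h3.trans (h1'.trans (.head ?_ (h3'.trans h1))))
  exact Or.inl h2'

lemma notMem_An_parents (hG : G.IsMAMP) (h : G.DescendingRoute a b) :
    b ∉ G.An {p | G.dir p a} := by
  rintro ⟨z, hz, hbz⟩
  exact hG.no_semidirected_cycle z a hz (h.trans hbz.descendingRoute)

lemma eq_tail_of_passes {E : Set V} (h : G.Passes Z E head ρ b) (hb : b ∉ G.An Z) : ρ = tail := by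
  cases ρ
  · rfl
  · exact absurd (h.1 trivial) hb
  · exact absurd (h.1 trivial) hb

lemma not_passes_tail {E : Set V} (h : G.Passes Z E tail ρ b) (hb : b ∈ Z) : False := by
  have := h.2 (by cases ρ <;> simp [Mark.Triplex])
  simp_all

/-- No node reached by a descending route from `a` is an ancestor of a parent of `a`. An open route
therefore meets no triplex node: it runs along undirected edges and, once it has turned to arrows,
only downwards. -/
lemma Exit.below_or_reachable (hG : G.IsMAMP) {E : Set V}
    (h : Exit G {p | G.dir p a} E w a k b ν) :
    b = a ∨ (ν = tail ∧ G.DescendingRoute a b) ∨ (ν = line ∧ G.undir.Reachable a b) := by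
  induction h with
  | start => exact Or.inl rfl
  | @step k b' b μ ν ρ h e p ih =>
    have htail : ν = head → G.DescendingRoute a b → ρ = tail := by
      rintro rfl hd
      exact eq_tail_of_passes p (notMem_An_parents hG hd)
    have hline : ν = line → G.undir.Reachable a b →
        (ρ = tail ∧ G.DescendingRoute a b) ∨ (ρ = line ∧ G.undir.Reachable a b) := by
      rintro rfl hr
      have hd := descendingRoute_of_reachable hr
      cases ρ
      · exact Or.inl ⟨rfl, hd⟩
      · exact Or.inr ⟨rfl, hr⟩
      · exact absurd (p.1 trivial) (notMem_An_parents hG hd)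
    rcases ih with rfl | ⟨rfl, hd⟩ | ⟨rfl, hr⟩
    · cases μ <;> cases ν <;> try exact e.elim
      · have hd := descendingRoute_of_into (Or.inl e)
        exact Or.inr (Or.inl ⟨htail rfl hd, hd⟩)
      · exact Or.inr (hline rfl (SimpleGraph.Adj.reachable e))
      · exact (not_passes_tail p e).elim
      · have hd := descendingRoute_of_into (Or.inr (Or.inr e))
        exact Or.inr (Or.inl ⟨htail rfl hd, hd⟩)
    · cases ν <;> try exact e.elim
      have hd' := hd.trans (descendingRoute_of_into (Or.inl e))
      exact Or.inr (Or.inl ⟨htail rfl hd', hd'⟩)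
    · cases ν <;> try exact e.elim
      exact Or.inr (hline rfl (hr.trans (SimpleGraph.Adj.reachable e)))

lemma not_entry_of_not_below (hG : G.IsMAMP) {E : Set V} (hac : ¬ G.skeleton.Adj a c)
    (hr : ¬ G.undir.Reachable a c) (hb : ¬ G.Below a c) :
    ¬ Entry G {p | G.dir p a} E w a c μ := by
  rintro ⟨k, b, ν, h, e⟩
  rcases h.below_or_reachable hG with rfl | ⟨rfl, hd⟩ | ⟨rfl, hr'⟩
  · exact hac e.adj
  · cases μ <;> try exact e.elim
    exact hb ⟨_, _, hd, e, .refl⟩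
  · cases μ <;> try exact e.elim
    exact hr (hr'.trans (SimpleGraph.Adj.reachable e))

/-- The undirected component of `a` and its parents, except for `a` and `c`. -/
def componentSet (G : MixedGraph V) (a c : V) : Set V :=
  {z | z ≠ a ∧ z ≠ c ∧ (G.undir.Reachable a z ∨ ∃ u, G.undir.Reachable a u ∧ G.dir z u)}

lemma notMem_An_componentSet (hG : G.IsMAMP) (hd : G.DescendingRoute a b)
    (hr : ¬ G.undir.Reachable a b) : b ∉ G.An (G.componentSet a c) := by
  rintro ⟨z, ⟨-, -, hz⟩, hbz⟩
  rcases hz with hz | ⟨u, hu, hzu⟩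
  · rcases Relation.ReflTransGen.cases_head hbz with rfl | ⟨d, hbd, hdz⟩
    · exact hr hz
    · exact hG.no_semidirected_cycle b d hbd ((StrictlyDescendingRoute.descendingRoute hdz).trans
        ((descendingRoute_of_reachable hz.symm).trans hd))
  · exact hG.no_semidirected_cycle z u hzu ((descendingRoute_of_reachable hu.symm).trans
      (hd.trans hbz.descendingRoute))

/-- The nodes that an open route from `a` may reach, given the undirected component of `a`. -/
lemma Exit.cases_of_reachable (hG : G.IsMAMP) (hac : ¬ G.skeleton.Adj a c)
    (hr : G.undir.Reachable a c)
    (h : Exit G (G.componentSet a c) (G.exempt (G.componentSet a c)) w a k b ν) :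
    b = a ∨ (ν = tail ∧ G.DescendingRoute a b ∧ ¬ G.undir.Reachable a b) ∨
      (G.undir.Adj a b ∧ (ν = head ∨ (ν = line ∧ ∃ d, G.bidir.Adj b d))) := by
  induction h with
  | start => exact Or.inl rfl
  | @step k b' b μ ν ρ h e p ih =>
    have hhead : ν = head → G.DescendingRoute a b → ¬ G.undir.Reachable a b → ρ = tail := by
      rintro rfl hd hn
      exact eq_tail_of_passes p (notMem_An_componentSet hG hd hn)
    have hcycle : ∀ {u v}, G.dir u v → G.undir.Reachable a u → ¬ G.undir.Reachable a v :=
      fun huv hu hv => hG.no_semidirected_cycle _ _ huv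
        (descendingRoute_of_reachable (hv.symm.trans hu))
    have hline : ν = line → G.undir.Adj a b → ρ = head ∨ (ρ = line ∧ ∃ d, G.bidir.Adj b d) := by
      rintro rfl hab
      have hb : b ∈ G.componentSet a c :=
        ⟨hab.ne', fun h => hac (h ▸ Or.inl hab), Or.inl hab.reachable⟩
      cases ρ
      · exact (not_passes_tail p.symm hb).elim
      · refine Or.inr ⟨rfl, ?_⟩
        rcases p.2 (fun h => h) with h1 | ⟨-, -, h1⟩
        · exact absurd hb h1
        rcases exists_of_mem_exempt h1 with h2 | ⟨d, hdb, hd⟩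
        · exact h2
        -- Only `a` and `c` are left out of the separator, and (C1) forbids them to be parents
        -- within their own undirected component.
        · refine absurd ⟨?_, ?_, Or.inr ⟨b, hab.reachable, hdb⟩⟩ hd
          · rintro rfl
            exact hcycle hdb (SimpleGraph.Reachable.refl _) hab.reachable
          · rintro rfl
            exact hcycle hdb hr hab.reachable
      · exact Or.inl rfl
    have hparent : ∀ {u}, G.undir.Reachable a u → G.dir b u → ν = tail → False := by
      rintro u hu hbu rfl
      refine not_passes_tail p ⟨?_, ?_, Or.inr ⟨u, hu, hbu⟩⟩
      · rintro rfl
        exact hcycle hbu (SimpleGraph.Reachable.refl _) hu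
      · rintro rfl
        exact hcycle hbu hr hu
    have hspouse : ∀ {u}, G.undir.Reachable a u → G.bidir.Adj u b → ν = head →
        ρ = tail ∧ G.DescendingRoute a b ∧ ¬ G.undir.Reachable a b := by
      intro u hu hub hν
      have hd := (descendingRoute_of_reachable hu).trans
        (descendingRoute_of_into (Or.inr (Or.inr hub)))
      have hn : ¬ G.undir.Reachable a b :=
        fun hn => hG.no_bidirected_cycle u b hub (hn.symm.trans hu)
      exact ⟨hhead hν hd hn, hd, hn⟩
    have hchild : ∀ {u}, G.DescendingRoute a u → G.dir u b → ν = head →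
        ρ = tail ∧ G.DescendingRoute a b ∧ ¬ G.undir.Reachable a b := by
      intro u hu hub hν
      have hd := hu.trans (descendingRoute_of_into (Or.inl hub))
      have hn : ¬ G.undir.Reachable a b := fun hn => hG.no_semidirected_cycle u b hub
        ((descendingRoute_of_reachable hn.symm).trans hu)
      exact ⟨hhead hν hd hn, hd, hn⟩
    rcases ih with rfl | ⟨rfl, hd, -⟩ | ⟨hab, rfl | ⟨rfl, d, hd⟩⟩
    · cases μ <;> cases ν <;> try exact e.elim
      · exact Or.inr (Or.inl (hchild .refl e rfl))
      · exact Or.inr (Or.inr ⟨e, hline rfl e⟩)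
      · exact (hparent (SimpleGraph.Reachable.refl _) e rfl).elim
      · exact Or.inr (Or.inl (hspouse (SimpleGraph.Reachable.refl _) e rfl))
    · cases ν <;> try exact e.elim
      exact Or.inr (Or.inl (hchild hd e rfl))
    · cases ν <;> try exact e.elim
      · exact (hparent hab.reachable e rfl).elim
      · exact Or.inr (Or.inl (hspouse hab.reachable e rfl))
    · cases ν <;> try exact e.elim
      -- By (C3), an undirected step past a neighbour of `a` that has a spouse ends in `a` or in
      -- another neighbour of `a`.
      by_cases hb : a = b
      · exact Or.inl hb.symm
      · have hab' := undir_of_bidir hG hb hab e hd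
        exact Or.inr (Or.inr ⟨hab', hline rfl hab'⟩)

lemma not_entry_of_reachable (hG : G.IsMAMP) (hne : a ≠ c) (hac : ¬ G.skeleton.Adj a c)
    (hr : G.undir.Reachable a c) :
    ¬ Entry G (G.componentSet a c) (G.exempt (G.componentSet a c)) w a c μ := by
  rintro ⟨k, b, ν, h, e⟩
  rcases h.cases_of_reachable hG hac hr with rfl | ⟨rfl, hd, -⟩ | ⟨hab, rfl | ⟨rfl, d, hd⟩⟩
  · exact hac e.adj
  · cases μ <;> try exact e.elim
    exact hG.no_semidirected_cycle _ _ e ((descendingRoute_of_reachable hr.symm).trans hd)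
  · cases μ <;> try exact e.elim
    · exact hG.no_semidirected_cycle _ _ e (descendingRoute_of_reachable
        (hab.symm.reachable.trans hr))
    · exact hG.no_bidirected_cycle _ _ e (hr.symm.trans hab.reachable)
  · cases μ <;> try exact e.elim
    exact hac (Or.inl (undir_of_bidir hG hne hab e hd))

lemma not_openConn_parents (hG : G.IsMAMP) (hne : a ≠ c) (hac : ¬ G.skeleton.Adj a c)
    (hr : ¬ G.undir.Reachable a c) (hb : ¬ G.Below a c) :
    ∃ Z, a ∉ Z ∧ c ∉ Z ∧ ¬ G.OpenConn Z a c := by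
  refine ⟨{p | G.dir p a}, G.dir_irrefl a, fun h => hac (Or.inr (Or.inr (Or.inl h))), fun h => ?_⟩
  obtain ⟨μ, h⟩ := h.exists_entry hne (fun _ => 0)
  exact not_entry_of_not_below hG hac hr hb h

/-- Two nodes that are not adjacent can be separated. -/
lemma exists_not_openConn (hG : G.IsMAMP) (hne : a ≠ c) (hac : ¬ G.skeleton.Adj a c) :
    ∃ Z, a ∉ Z ∧ c ∉ Z ∧ ¬ G.OpenConn Z a c := by
  by_cases hr : G.undir.Reachable a c
  · refine ⟨G.componentSet a c, fun h => h.1 rfl, fun h => h.2.1 rfl, fun h => ?_⟩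
    obtain ⟨μ, h⟩ := h.exists_entry hne (fun _ => 0)
    exact not_entry_of_reachable hG hne hac hr h
  -- At most one of `a` and `c` is strictly below the other; the parents of the lower one separate
  -- them.
  by_cases hb : G.Below a c
  · obtain ⟨Z, h1, h2, h3⟩ := not_openConn_parents hG hne.symm (fun h => hac h.symm)
      (fun h => hr h.symm) (not_below_symm hG hb)
    exact ⟨Z, h2, h1, fun h => h3 h.symm⟩
  · exact not_openConn_parents hG hne hac hr hb

/-! ### The two implications. -/

variable {H : MixedGraph V}

lemma mem_triplexes {a c b : V} : (s(a, c), b) ∈ G.triplexes ↔ G.HasTriplex a c b := by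
  constructor
  · rintro ⟨a', c', h, h1, h2, h3⟩
    simp only [Sym2.eq_iff] at h
    rcases h with ⟨rfl, rfl⟩ | ⟨rfl, rfl⟩
    · exact ⟨h1, h2, h3⟩
    · exact ⟨h1.symm, fun h => h2 h.symm, h3.symm⟩
  · exact fun h => ⟨a, c, rfl, h⟩

lemma mem_independenceModel_singleton (hG : G.IsMAMP) (hne : a ≠ c) (ha : a ∉ Z) (hc : c ∉ Z) :
    (({a}, {c}, Z) : Set V × Set V × Set V) ∈ G.independenceModel ↔ ¬ G.OpenConn Z a c := by
  have h : G.Separated {a} {c} Z ↔ ¬ G.OpenConn Z a c := by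
    rw [← openConn_iff hG ha hc]
    simp [Separated]
  rw [← h]
  simp [independenceModel, hne, ha, hc]

lemma MarkovEquivalent.openConn_iff (h : G.MarkovEquivalent H) (hG : G.IsMAMP) (hH : H.IsMAMP)
    (hne : a ≠ c) (ha : a ∉ Z) (hc : c ∉ Z) : G.OpenConn Z a c ↔ H.OpenConn Z a c := by
  rw [← not_iff_not, ← mem_independenceModel_singleton hG hne ha hc,
    ← mem_independenceModel_singleton hH hne ha hc, h]

lemma OpenConn.of_adj (h : G.skeleton.Adj a c) : G.OpenConn Z a c :=
  ⟨[a, c], openList_pair h, rfl, rfl⟩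

lemma MarkovEquivalent.adj (h : G.MarkovEquivalent H) (hG : G.IsMAMP) (hH : H.IsMAMP)
    (hac : G.skeleton.Adj a c) : H.skeleton.Adj a c := by
  by_contra hn
  obtain ⟨Z, h1, h2, h3⟩ := exists_not_openConn hH hac.ne hn
  exact h3 ((h.openConn_iff hG hH hac.ne h1 h2).1 (.of_adj hac))

/-- Take `Z` separating `a` from `c` in `G`, hence in `H`. If `b` is in `Z`, the triplex opens `a,
b, c` in `G`; if not, a non-triplex would open it in `H`. -/
lemma MarkovEquivalent.hasTriplex (h : G.MarkovEquivalent H) (hG : G.IsMAMP) (hH : H.IsMAMP)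
    (ht : G.HasTriplex a c b) : H.HasTriplex a c b := by
  obtain ⟨hne, hac, ht⟩ := ht
  have hac' : ¬ H.skeleton.Adj a c := fun h1 => hac (MarkovEquivalent.adj (Eq.symm h) hH hG h1)
  refine ⟨hne, hac', ?_⟩
  by_contra hn
  obtain ⟨Z, h1, h2, h3⟩ := exists_not_openConn hG hne hac
  have h4 := mt (h.openConn_iff hG hH hne h1 h2).2 h3
  have hab := ht.into.adj
  have hbc := ht.into_right.adj.symm
  by_cases hb : b ∈ Z
  · exact h3 ⟨[a, b, c], openList_triple hab hbc ⟨fun _ => subset_An hb, fun h => absurd ht h⟩,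
      rfl, rfl⟩
  · exact h4 ⟨[a, b, c], openList_triple (h.adj hG hH hab) (h.adj hG hH hbc)
      ⟨fun h => absurd h hn, fun _ => Or.inl hb⟩, rfl, rfl⟩

lemma MarkovEquivalent.triplexEquivalent (h : G.MarkovEquivalent H) (hG : G.IsMAMP)
    (hH : H.IsMAMP) : G.TriplexEquivalent H := by
  have h' : H.MarkovEquivalent G := Eq.symm h
  refine ⟨?_, ?_⟩
  · ext a c
    exact ⟨h.adj hG hH, h'.adj hH hG⟩
  · ext ⟨s, b⟩
    induction s with
    | _ a c =>
      rw [mem_triplexes, mem_triplexes]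
      exact ⟨h.hasTriplex hG hH, h'.hasTriplex hH hG⟩

lemma TriplexEquivalent.openConn [Finite V] (h : G.TriplexEquivalent H) (hG : G.IsMAMP)
    (hH : H.IsMAMP) (hne : a ≠ c) (ha : a ∉ Z) (hc : c ∉ Z) (ho : G.OpenConn Z a c) :
    H.OpenConn Z a c := by
  obtain ⟨μ, h1⟩ := ho.exists_entry hne (fun _ => 0)
  obtain ⟨ν, h2⟩ := h1.exists_entry hG hne
  have ht : ∀ a b c, a ≠ c → ¬ G.skeleton.Adj a c → G.skeleton.Adj a b → G.skeleton.Adj b c →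
      (H.TriplexPattern a b c ↔ G.TriplexPattern a b c) := by
    intro a b c hne hac _ _
    have h4 : H.HasTriplex a c b ↔ G.HasTriplex a c b := by
      rw [← mem_triplexes, ← mem_triplexes, h.2]
    have hac' : ¬ H.skeleton.Adj a c := by rwa [← h.1]
    exact ⟨fun ht => (h4.1 ⟨hne, hac', ht⟩).2.2, fun ht => (h4.2 ⟨hne, hac, ht⟩).2.2⟩
  obtain ⟨w, ρ, h3⟩ := exists_entry_of_triplexEquivalent hG hH (fun a b => by rw [h.1]) ht hne
    ha hc ⟨_, _, h2⟩
  exact h3.openConn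

lemma TriplexEquivalent.independenceModel_subset [Finite V] (h : G.TriplexEquivalent H)
    (hG : G.IsMAMP) (hH : H.IsMAMP) : H.independenceModel ⊆ G.independenceModel := by
  rintro ⟨X, Y, Z⟩ ⟨hXY, hXZ, hYZ, hs⟩
  refine ⟨hXY, hXZ, hYZ, fun x hx y hy hp => hs x hx y hy ?_⟩
  have hxZ := Set.disjoint_left.1 hXZ hx
  have hyZ := Set.disjoint_left.1 hYZ hy
  have hne : x ≠ y := fun hxy => Set.disjoint_left.1 hXY hx (hxy ▸ hy)
  rw [MixedGraph.openConn_iff hG hxZ hyZ] at hp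
  rw [MixedGraph.openConn_iff hH hxZ hyZ]
  exact h.openConn hG hH hne hxZ hyZ hp

end MixedGraph

theorem theorem5 {V : Type*} [Finite V] (G H : MixedGraph V) (hG : G.IsMAMP) (hH : H.IsMAMP) :
    G.MarkovEquivalent H ↔ G.TriplexEquivalent H := by
  refine ⟨fun h => h.triplexEquivalent hG hH, fun h => ?_⟩
  have h' : H.TriplexEquivalent G := ⟨h.1.symm, h.2.symm⟩
  exact Set.Subset.antisymm (h'.independenceModel_subset hH hG) (h.independenceModel_subset hG hH)
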